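/- **Setting.** Let $\sigma<0$, $\lambda>0$, $\beta>0$, $\rho>0$. For $L>0$ let $\epsilon_L(0)<\epsilon_L(1)<\epsilon_L(2)<\dots$ be the eigenvalues, in increasing order, of $-\frac{d^2}{dx^2}$ on $[-L/2,L/2]$ with the attractive boundary conditions $\phi'(-L/2)=\sigma\phi(-L/2)$, $\phi'(L/2)=-\sigma\phi(L/2)$. On the boson Fock space $\mathcal F_L$ over $L^2([-L/2,L/2])$, represented by the occupation numbers of the eigenmodes, let $a_k^*,a_k$ be the creation and annihilation operators of the $k$-th normalized eigenfunction, $N_k=a_k^*a_k$, $N_L=\sum_{k\ge 0}N_k$, $\tilde N_L=\sum_{k\ge 2}N_k$, and $$H_L=\sum_{k\ge 0}\epsilon_L(k)\,a_k^*a_k+\frac{\lambda}{2}\frac{\tilde N_L^2}{L}.$$ The grand canonical equilibrium state at inverse temperature $\beta$ and chemical potential $\mu_L$ is $$\omega_L(X)=\frac{\mathrm{Tr}_{\mathcal F_L}\,X e^{-\beta(H_L-\mu_LN_L)}}{\mathrm{Tr}_{\mathcal F_L}\,e^{-\beta(H_L-\mu_LN_L)}}.$$ For all sufficiently large $L$ let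 $\mu_L\in\mathbb R$ be such that $e^{-\beta(H_L-\mu_LN_L)}$ is of trace class and $\omega_L(N_L)/L=\rho$. **Theorem.** The limit $$\rho_{cond}=\lim_{L\to\infty}\frac1L\,\omega_L(N_0+N_1)\ \ge 0$$ exists, and the following hold. (i) The condensate is equally distributed on the two lowest energy levels: $$\lim_{L\to\infty}\frac{\omega_L(N_0)}{L}=\lim_{L\to\infty}\frac{\omega_L(N_1)}{L}=\frac{\rho_{cond}}{2}.$$ (ii) If $\rho_{cond}>0$, then, as $L\to\infty$, $$\mu_L=-\sigma^2-\frac{2}{\beta\rho_{cond}L}+o(L^{-1}).$$ -/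

import Mathlib

noncomputable section

namespace AttractiveBose

/-! ### The one-particle problem on `[-L/2, L/2]` with boundary parameter `σ` -/

/-- `e` is an eigenvalue of `-d²/dx²` on `[-L/2, L/2]` with the boundary conditions
`φ' - σ φ = 0` at `-L/2` and `φ' + σ φ = 0` at `L/2`. Here `dφ` is the derivative of the
eigenfunction `φ` (one-sided at the end points). -/
def IsLevel (σ L e : ℝ) : Prop :=
  ∃ φ dφ : ℝ → ℝ,
    (∀ x ∈ Set.Icc (-L / 2) (L / 2),
      HasDerivWithinAt φ (dφ x) (Set.Icc (-L / 2) (L / 2)) x) ∧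
    (∀ x ∈ Set.Icc (-L / 2) (L / 2),
      HasDerivWithinAt dφ (-(e * φ x)) (Set.Icc (-L / 2) (L / 2)) x) ∧
    dφ (-L / 2) - σ * φ (-L / 2) = 0 ∧
    dφ (L / 2) + σ * φ (L / 2) = 0 ∧
    ∃ x ∈ Set.Icc (-L / 2) (L / 2), φ x ≠ 0

/-- The energy levels `ε_L(0) < ε_L(1) < ε_L(2) < …`: the eigenvalues in increasing order.
(Every eigenvalue is simple: a solution of `-φ'' = e φ` is determined by its value at `-L/2`
and the boundary condition there, so no multiplicity has to be recorded.) -/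
def level (σ L : ℝ) : ℕ → ℝ
  | 0 => sInf {e | IsLevel σ L e}
  | k + 1 => sInf {e | IsLevel σ L e ∧ level σ L k < e}

/-! ### Boson Fock space in the occupation number representation

The boson Fock space has the orthonormal basis `|n⟩` indexed by the occupation numbers
`n = (n₀, n₁, …)`, finitely many of them nonzero, of the one-particle eigenmodes `φ₀, φ₁, …`.
All the operators act on the dense subspace of finite linear combinations of basis vectors. -/

/-- Occupation numbers of the modes. -/
abbrev Occ : Type := ℕ →₀ ℕ

/-- Finite linear combinations of the basis vectors `|n⟩`: the common dense invariant domain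
in the Fock space. -/
abbrev FockCore : Type := Occ →₀ ℂ

/-- The basis vector `|n⟩`. -/
def ket (n : Occ) : FockCore := Finsupp.single n 1

/-- The operator with prescribed values on the basis vectors. -/
def opOfKet (f : Occ → FockCore) : FockCore →ₗ[ℂ] FockCore := Finsupp.linearCombination ℂ f

/-- The annihilation operator `a_k`: `a_k |n⟩ = √(n_k) |n - δ_k⟩`. -/
def annihilate (k : ℕ) : FockCore →ₗ[ℂ] FockCore :=
  opOfKet fun n => ((Real.sqrt (n k) : ℝ) : ℂ) • ket (n - Finsupp.single k 1)

/-- The creation operator `a_k^*`: `a_k^* |n⟩ = √(n_k + 1) |n + δ_k⟩`. -/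
def create (k : ℕ) : FockCore →ₗ[ℂ] FockCore :=
  opOfKet fun n => ((Real.sqrt ((n k : ℝ) + 1) : ℝ) : ℂ) • ket (n + Finsupp.single k 1)

/-- The number operator `N_k = a_k^* a_k`. -/
def number (k : ℕ) : FockCore →ₗ[ℂ] FockCore := create k ∘ₗ annihilate k

/-- The operator `∑_k c_k a_k^* a_k`. On each basis vector only finitely many terms of the sum
are nonzero. -/
def modeSum (c : ℕ → ℝ) : FockCore →ₗ[ℂ] FockCore :=
  opOfKet fun n => ∑ᶠ k : ℕ, (c k : ℂ) • number k (ket n)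

/-- The total number operator `N = ∑_k N_k`. -/
def totalNumber : FockCore →ₗ[ℂ] FockCore := modeSum fun _ => 1

/-- The number operator `Ñ = ∑_{k ≥ 2} N_k`. -/
def upperNumber : FockCore →ₗ[ℂ] FockCore := modeSum fun k => if 2 ≤ k then 1 else 0

/-- The Hamiltonian `H_L = ∑_k ε_L(k) a_k^* a_k + (lam / 2) Ñ² / L`. -/
def hamiltonian (σ lam L : ℝ) : FockCore →ₗ[ℂ] FockCore :=
  modeSum (level σ L) + ((lam / 2 / L : ℝ) : ℂ) • (upperNumber ∘ₗ upperNumber)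

/-- `H_L - μ N_L`. -/
def grandHamiltonian (σ lam L μ : ℝ) : FockCore →ₗ[ℂ] FockCore :=
  hamiltonian σ lam L - (μ : ℂ) • totalNumber

/-- The diagonal matrix element `⟨n| A |n⟩`. -/
def diagElem (A : FockCore →ₗ[ℂ] FockCore) (n : Occ) : ℂ := A (ket n) n

theorem opOfKet_ket (f : Occ → FockCore) (n : Occ) : opOfKet f (ket n) = f n := by
  simp [opOfKet, ket, Finsupp.linearCombination_single]

theorem number_ket (k : ℕ) (n : Occ) : number k (ket n) = (n k : ℂ) • ket n := by
  rw [number, LinearMap.comp_apply, annihilate, opOfKet_ket, map_smul, create, opOfKet_ket,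
    smul_smul]
  rcases Nat.eq_zero_or_pos (n k) with h | h
  · simp [h]
  · have h1 : n - Finsupp.single k 1 + Finsupp.single k 1 = n := by
      apply tsub_add_cancel_of_le
      exact Finsupp.single_le_iff.mpr h
    have h2 : (((n - Finsupp.single k 1 : Occ) k : ℕ) : ℝ) + 1 = n k := by
      have h3 := DFunLike.congr_fun h1 k
      rw [Finsupp.add_apply, Finsupp.single_eq_same] at h3
      exact_mod_cast h3
    rw [h1, h2, ← Complex.ofReal_mul, Real.mul_self_sqrt (Nat.cast_nonneg _)]
    simp

theorem modeSum_ket (c : ℕ → ℝ) (n : Occ) :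
    modeSum c (ket n) = ((n.sum fun k m => c k * m : ℝ) : ℂ) • ket n := by
  rw [modeSum, opOfKet_ket]
  rw [finsum_eq_sum_of_support_subset (s := n.support)]
  · simp only [number_ket, smul_smul, ← Finset.sum_smul]
    simp [Finsupp.sum]
  · intro k hk
    by_contra h
    apply hk
    have : n k = 0 := by simpa using h
    simp [number_ket, this]

/-- `H_L - μ N_L` is diagonal in the occupation number basis. -/
theorem grandHamiltonian_ket (σ lam L μ : ℝ) (n : Occ) :
    grandHamiltonian σ lam L μ (ket n) = diagElem (grandHamiltonian σ lam L μ) n • ket n := by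
  have key : ∃ c : ℂ, grandHamiltonian σ lam L μ (ket n) = c • ket n := by
    simp only [grandHamiltonian, hamiltonian, totalNumber, upperNumber, LinearMap.sub_apply,
      LinearMap.add_apply, LinearMap.smul_apply, LinearMap.comp_apply, modeSum_ket, map_smul,
      smul_smul, ← add_smul, ← sub_smul]
    exact ⟨_, rfl⟩
  obtain ⟨c, hc⟩ := key
  rw [diagElem, hc]
  simp [ket]

/-- The Gibbs operator `exp(-β (H_L - μ N_L))`. Since `|n⟩` is an eigenvector of `H_L - μ N_L`
(`grandHamiltonian_ket`), it acts on `|n⟩` by the exponential of the eigenvalue. -/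
def gibbsOp (σ lam β L μ : ℝ) : FockCore →ₗ[ℂ] FockCore :=
  opOfKet fun n =>
    Complex.exp (-(β : ℂ) * diagElem (grandHamiltonian σ lam L μ) n) • ket n

/-- The trace `∑_n ⟨n| A |n⟩` over the Fock space. -/
def fockTrace (A : FockCore →ₗ[ℂ] FockCore) : ℂ := ∑' n : Occ, diagElem A n

/-- The Gibbs operator, which is positive and diagonal, is of trace class, so that the grand
canonical state at chemical potential `μ` exists. -/
def GibbsTraceClass (σ lam β L μ : ℝ) : Prop :=
  Summable fun n : Occ => diagElem (gibbsOp σ lam β L μ) n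

/-- The grand canonical equilibrium state
`ω_L(X) = Tr (X exp(-β (H_L - μ N_L))) / Tr exp(-β (H_L - μ N_L))`. -/
def gibbsState (σ lam β L μ : ℝ) (X : FockCore →ₗ[ℂ] FockCore) : ℂ :=
  fockTrace (X ∘ₗ gibbsOp σ lam β L μ) / fockTrace (gibbsOp σ lam β L μ)

end AttractiveBose

end

noncomputable section

namespace AttractiveBose

open Real Set Filter Topology

/-! The attractive walls bind one even and one odd state, with energies `-a ^ 2 < -σ ^ 2 < -b ^ 2`
exponentially close to `-σ ^ 2`. All other levels are positive and interlace with the squares of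
multiples of `π / L` (`level_bounds`).

The interaction involves only the upper modes, so modes 0 and 1 are free bosons at chemical
potential `μ`. The upper modes form a mean-field gas. Give them an auxiliary chemical potential `α <
0` with `α + lam * freeDensity β α = -σ ^ 2`. Completing the square turns the Gibbs weight into a
free product weight times a Gaussian in `Ñ`, whose centre is the free mean up to `O(1) + L * |μ + σ
^ 2| / lam`. Chebyshev's correlation inequality says that such a Gaussian can only reduce the mean
square distance to its centre. Since `α` is negative, the free variance is `O(L)`, hence `⟨Ñ⟩ = L *
d + O(√L) + O(L * |μ + σ ^ 2|)` with `d = freeDensity β α` (`gibbsState_bounds`). As `μ < -σ ^ 2`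
and `⟨Ñ⟩` increases with the tilt, `⟨Ñ⟩ ≤ L * d + O(√L)` holds in any case.

The condensate density is `max 0 (ρ - d)` (`condensate_limits`). The upper bound on `⟨Ñ⟩` shows that
it is at least this large. If it stays away from zero, the lowest level is macroscopically occupied,
so `μ` is within `O(1 / L)` of `-σ ^ 2` and the upper density tends to `d`. The splitting of the two
levels is negligible against `1 / L`, which makes their occupations equal. Inverting the Bose law
for level 0 gives the expansion of `μ`. -/

/-! ### The characteristic equation -/

/-- The Wronskian of two solutions of `-φ'' = e φ` is constant. -/
theorem wronskian_const {a e : ℝ} {f df g dg : ℝ → ℝ}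
    (hf : ∀ x ∈ Icc (-a) a, HasDerivWithinAt f (df x) (Icc (-a) a) x)
    (hdf : ∀ x ∈ Icc (-a) a, HasDerivWithinAt df (-(e * f x)) (Icc (-a) a) x)
    (hg : ∀ x ∈ Icc (-a) a, HasDerivWithinAt g (dg x) (Icc (-a) a) x)
    (hdg : ∀ x ∈ Icc (-a) a, HasDerivWithinAt dg (-(e * g x)) (Icc (-a) a) x)
    {x y : ℝ} (hx : x ∈ Icc (-a) a) (hy : y ∈ Icc (-a) a) :
    f x * dg x - df x * g x = f y * dg y - df y * g y := by
  have key : ∀ z ∈ Icc (-a) a,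
      HasDerivWithinAt (fun x => f x * dg x - df x * g x) 0 (Icc (-a) a) z := by
    intro z hz
    exact (((hf z hz).mul (hdg z hz)).sub ((hdf z hz).mul (hg z hz))).congr_deriv (by ring)
  have h1 := constant_of_derivWithin_zero (f := fun x => f x * dg x - df x * g x)
    (fun z hz => (key z hz).differentiableWithinAt)
    (fun z hz => (key z ⟨hz.1, hz.2.le⟩).derivWithin
      (uniqueDiffOn_Icc (lt_of_le_of_lt hz.1 hz.2) z ⟨hz.1, hz.2.le⟩))
  exact (h1 x hx).trans (h1 y hy).symm

/-- An energy is a level iff the even or the odd solution satisfies the boundary condition. -/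
theorem isLevel_iff {σ L e : ℝ} (hL : 0 < L) {u du v dv : ℝ → ℝ}
    (hu : ∀ x, HasDerivAt u (du x) x) (hdu : ∀ x, HasDerivAt du (-(e * u x)) x)
    (hv : ∀ x, HasDerivAt v (dv x) x) (hdv : ∀ x, HasDerivAt dv (-(e * v x)) x)
    (hu0 : u 0 = 1) (hdu0 : du 0 = 0) (hv0 : v 0 = 0) (hdv0 : dv 0 = 1)
    (hue : ∀ x, u (-x) = u x) (hdue : ∀ x, du (-x) = -du x)
    (hve : ∀ x, v (-x) = -v x) (hdve : ∀ x, dv (-x) = dv x) :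
    IsLevel σ L e ↔ du (L / 2) + σ * u (L / 2) = 0 ∨ dv (L / 2) + σ * v (L / 2) = 0 := by
  have hm : (0 : ℝ) ∈ Icc (-(L / 2)) (L / 2) := ⟨by linarith, by linarith⟩
  have hr : L / 2 ∈ Icc (-(L / 2)) (L / 2) := ⟨by linarith, le_rfl⟩
  have hl : -(L / 2) ∈ Icc (-(L / 2)) (L / 2) := ⟨le_rfl, by linarith⟩
  have hW : ∀ x ∈ Icc (-(L / 2)) (L / 2), u x * dv x - du x * v x = 1 := by
    intro x hx
    rw [wronskian_const (fun x _ => (hu x).hasDerivWithinAt) (fun x _ => (hdu x).hasDerivWithinAt)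
      (fun x _ => (hv x).hasDerivWithinAt) (fun x _ => (hdv x).hasDerivWithinAt) hx hm,
      hu0, hdu0, hdv0]
    ring
  simp only [IsLevel, neg_div]
  constructor
  · rintro ⟨φ, dφ, hφ, hdφ, hbl, hbr, x, hx, hne⟩
    have hP : ∀ x ∈ Icc (-(L / 2)) (L / 2), φ x * dv x - dφ x * v x = φ 0 := by
      intro x hx
      rw [wronskian_const hφ hdφ
        (fun x _ => (hv x).hasDerivWithinAt) (fun x _ => (hdv x).hasDerivWithinAt) hx hm, hv0, hdv0]
      ring
    have hQ : ∀ x ∈ Icc (-(L / 2)) (L / 2), φ x * du x - dφ x * u x = -dφ 0 := by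
      intro x hx
      rw [wronskian_const hφ hdφ
        (fun x _ => (hu x).hasDerivWithinAt) (fun x _ => (hdu x).hasDerivWithinAt) hx hm, hu0, hdu0]
      ring
    have h1 : ∀ x ∈ Icc (-(L / 2)) (L / 2), φ x = φ 0 * u x + dφ 0 * v x := by
      intro x hx
      -- Cramer's rule in the basis `u`, `v`, whose Wronskian is 1.
      linear_combination (-φ x) * hW x hx + u x * hP x hx - v x * hQ x hx
    have h2 : ∀ x ∈ Icc (-(L / 2)) (L / 2), dφ x = φ 0 * du x + dφ 0 * dv x := by
      intro x hx
      linear_combination (-dφ x) * hW x hx + du x * hP x hx - dv x * hQ x hx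
    rw [h1 _ hl, h2 _ hl, hue, hdue, hve, hdve] at hbl
    rw [h1 _ hr, h2 _ hr] at hbr
    by_contra hcon
    push Not at hcon
    -- By parity, the difference of the two boundary conditions sees only the coefficient of `u`,
    -- and their sum only that of `v`.
    have ha : φ 0 = 0 := by
      have : φ 0 * (du (L / 2) + σ * u (L / 2)) = 0 := by linear_combination (hbr - hbl) / 2
      exact (mul_eq_zero.1 this).resolve_right hcon.1
    have hb : dφ 0 = 0 := by
      have : dφ 0 * (dv (L / 2) + σ * v (L / 2)) = 0 := by linear_combination (hbr + hbl) / 2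
      exact (mul_eq_zero.1 this).resolve_right hcon.2
    exact hne (by rw [h1 x hx, ha, hb]; ring)
  · rintro (h | h)
    · refine ⟨u, du, fun x _ => (hu x).hasDerivWithinAt, fun x _ => (hdu x).hasDerivWithinAt,
        ?_, h, 0, hm, by simp [hu0]⟩
      rw [hue, hdue]
      linear_combination -h
    · refine ⟨v, dv, fun x _ => (hv x).hasDerivWithinAt, fun x _ => (hdv x).hasDerivWithinAt,
        ?_, h, L / 2, hr, fun h0 => ?_⟩
      · rw [hve, hdve]
        linear_combination h
      -- If `v` vanished at the wall, the boundary condition would make its derivative vanish too,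
      -- against Wronskian 1.
      · have h1 := hW _ hr
        rw [h0] at h h1
        have : dv (L / 2) = 0 := by simpa using h
        simp [this] at h1

theorem isLevel_zero_iff {σ L : ℝ} (hL : 0 < L) :
    IsLevel σ L 0 ↔ σ = 0 ∨ 1 + σ * (L / 2) = 0 := by
  rw [isLevel_iff hL (u := fun _ => 1) (du := fun _ => 0) (v := fun x => x) (dv := fun _ => 1)
    (fun x => hasDerivAt_const x _) (fun x => by simpa using hasDerivAt_const x (0 : ℝ))
    (fun x => hasDerivAt_id x) (fun x => by simpa using hasDerivAt_const x (1 : ℝ))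
    rfl rfl rfl rfl (by simp) (by simp) (by simp) (by simp)]
  simp

theorem isLevel_sq_iff {σ L κ : ℝ} (hL : 0 < L) (hκ : 0 < κ) :
    IsLevel σ L (κ ^ 2) ↔
      -κ * sin (κ * (L / 2)) + σ * cos (κ * (L / 2)) = 0 ∨
        κ * cos (κ * (L / 2)) + σ * sin (κ * (L / 2)) = 0 := by
  have hid : ∀ x, HasDerivAt (fun x : ℝ => κ * x) κ x := fun x => by
    simpa using (hasDerivAt_id x).const_mul κ
  rw [isLevel_iff hL (u := fun x => cos (κ * x)) (du := fun x => -κ * sin (κ * x))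
    (v := fun x => sin (κ * x) / κ) (dv := fun x => cos (κ * x))
    (fun x => (hid x).cos.congr_deriv (by ring))
    (fun x => ((hid x).sin.const_mul (-κ)).congr_deriv (by ring))
    (fun x => ((hid x).sin.div_const κ).congr_deriv (by field_simp))
    (fun x => (hid x).cos.congr_deriv (by field_simp))
    (by simp) (by simp) (by simp) (by simp) (by simp) (by simp) (by simp [neg_div]) (by simp)]
  refine or_congr Iff.rfl ?_
  have : κ * cos (κ * (L / 2)) + σ * sin (κ * (L / 2))
      = κ * (cos (κ * (L / 2)) + σ * (sin (κ * (L / 2)) / κ)) := by field_simp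
  rw [this, mul_eq_zero, or_iff_right hκ.ne']

theorem isLevel_neg_sq_iff {σ L κ : ℝ} (hL : 0 < L) (hκ : 0 < κ) :
    IsLevel σ L (-κ ^ 2) ↔
      κ * sinh (κ * (L / 2)) + σ * cosh (κ * (L / 2)) = 0 ∨
        κ * cosh (κ * (L / 2)) + σ * sinh (κ * (L / 2)) = 0 := by
  have hid : ∀ x, HasDerivAt (fun x : ℝ => κ * x) κ x := fun x => by
    simpa using (hasDerivAt_id x).const_mul κ
  rw [isLevel_iff hL (u := fun x => cosh (κ * x)) (du := fun x => κ * sinh (κ * x))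
    (v := fun x => sinh (κ * x) / κ) (dv := fun x => cosh (κ * x))
    (fun x => (hid x).cosh.congr_deriv (by ring))
    (fun x => ((hid x).sinh.const_mul κ).congr_deriv (by ring))
    (fun x => ((hid x).sinh.div_const κ).congr_deriv (by field_simp))
    (fun x => (hid x).cosh.congr_deriv (by field_simp))
    (by simp) (by simp) (by simp) (by simp) (by simp) (by simp) (by simp [neg_div]) (by simp)]
  refine or_congr Iff.rfl ?_
  have : κ * cosh (κ * (L / 2)) + σ * sinh (κ * (L / 2))
      = κ * (cosh (κ * (L / 2)) + σ * (sinh (κ * (L / 2)) / κ)) := by field_simp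
  rw [this, mul_eq_zero, or_iff_right hκ.ne']

/-! ### The positive levels -/

/-- The phase whose values at multiples of `π` give the positive levels. -/
def phase (σ L κ : ℝ) : ℝ := κ * L - 2 * arctan (κ / -σ)

theorem arctan_sub_le {a b : ℝ} (h : a ≤ b) : arctan b - arctan a ≤ b - a := by
  have : MonotoneOn (fun x => x - arctan x) univ := by
    apply monotoneOn_of_deriv_nonneg convex_univ
    · exact (continuous_id.sub continuous_arctan).continuousOn
    · exact (differentiable_id.sub differentiable_arctan).differentiableOn
    · intro x _
      rw [deriv_fun_sub differentiableAt_fun_id (differentiableAt_arctan x)]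
      simp only [deriv_id'', Real.deriv_arctan]
      have : 1 / (1 + x ^ 2) ≤ 1 := by
        rw [div_le_one (by positivity)]
        nlinarith
      linarith
  have := this (mem_univ a) (mem_univ b) h
  simp only at this
  linarith

/-- The slope `L` of the linear term beats `2 / -σ`, a Lipschitz constant of the arctangent term. -/
theorem phase_strictMono {σ L : ℝ} (hσ : σ < 0) (hL : 2 / -σ < L) : StrictMono (phase σ L) := by
  intro a b hab
  have hs : 0 < -σ := by linarith
  have h1 := arctan_sub_le (div_le_div_of_nonneg_right hab.le hs.le)
  have h2 : 2 * (b / -σ - a / -σ) < b * L - a * L := by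
    have : 2 * (b / -σ - a / -σ) = (2 / -σ) * (b - a) := by ring
    rw [this]
    nlinarith
  simp only [phase]
  linarith

/-- Writing `σ` and `κ` through the angle `δ = arctan (κ / -σ)` turns the even and odd conditions
into `cos (θ - δ) = 0` and `sin (θ - δ) = 0`, with `θ = κ * L / 2`. Together they say that the sine
of the double angle, which is the phase, vanishes. -/
theorem isLevel_sq_iff_phase {σ L κ : ℝ} (hσ : σ < 0) (hL : 0 < L) (hκ : 0 < κ) :
    IsLevel σ L (κ ^ 2) ↔ ∃ j : ℤ, phase σ L κ = j * π := by
  have hs : 0 < -σ := by linarith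
  rw [isLevel_sq_iff hL hκ]
  set θ := κ * (L / 2) with hθ
  set δ := arctan (κ / -σ) with hδ
  have hc : 0 < cos δ := cos_arctan_pos _
  have ht : sin δ * -σ = κ * cos δ := by
    have := tan_arctan (κ / -σ)
    rw [← hδ, tan_eq_sin_div_cos, div_eq_div_iff hc.ne' hs.ne'] at this
    exact this
  have h1 : phase σ L κ = 2 * (θ - δ) := by rw [phase, hθ]; ring
  have e1 : (-κ * sin θ + σ * cos θ) * cos δ = σ * cos (θ - δ) := by
    rw [cos_sub]; linear_combination (sin θ) * ht
  have e2 : (κ * cos θ + σ * sin θ) * cos δ = σ * sin (θ - δ) := by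
    rw [sin_sub]; linear_combination (-cos θ) * ht
  have i1 : -κ * sin θ + σ * cos θ = 0 ↔ cos (θ - δ) = 0 := by
    rw [← mul_eq_zero_iff_right hc.ne', e1, mul_eq_zero, or_iff_right hσ.ne]
  have i2 : κ * cos θ + σ * sin θ = 0 ↔ sin (θ - δ) = 0 := by
    rw [← mul_eq_zero_iff_right hc.ne', e2, mul_eq_zero, or_iff_right hσ.ne]
  have i3 : (cos (θ - δ) = 0 ∨ sin (θ - δ) = 0) ↔ sin (2 * (θ - δ)) = 0 := by
    rw [sin_two_mul]
    simp [or_comm]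
  rw [i1, i2, i3, h1, sin_eq_zero_iff]
  exact ⟨fun ⟨n, h⟩ => ⟨n, h.symm⟩, fun ⟨n, h⟩ => ⟨n, h.symm⟩⟩

/-- The enumeration of the positive levels. -/
theorem exists_positive_levels {σ L : ℝ} (hσ : σ < 0) (hL : 2 / -σ < L) :
    ∃ κ : ℕ → ℝ, StrictMono κ ∧
      (∀ k, (k + 1) * (π / L) ≤ κ k ∧ κ k ≤ (k + 2) * (π / L)) ∧
      ∀ x, 0 < x → (IsLevel σ L (x ^ 2) ↔ ∃ k, κ k = x) := by
  have hs : 0 < -σ := by linarith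
  have hL0 : 0 < L := lt_trans (by positivity) hL
  have hmono := phase_strictMono hσ hL
  have hcont : Continuous (phase σ L) := by unfold phase; fun_prop
  -- For `x ≥ 0` the phase lies between `x * L - π` and `x * L`, so it passes `(k + 1) * π` between
  -- these two grid points.
  have hex : ∀ k : ℕ, ∃ x, ((k + 1) * (π / L) ≤ x ∧ x ≤ (k + 2) * (π / L)) ∧
      phase σ L x = ((k + 1 : ℕ) : ℝ) * π := by
    intro k
    have hle : (k + 1 : ℝ) * (π / L) ≤ (k + 2) * (π / L) := by
      have : 0 < π / L := by positivity
      nlinarith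
    have ha : phase σ L ((k + 1) * (π / L)) ≤ ((k + 1 : ℕ) : ℝ) * π := by
      have h0 : 0 ≤ arctan ((k + 1) * (π / L) / -σ) := arctan_nonneg.2 (by positivity)
      have h1 : (k + 1 : ℝ) * (π / L) * L = (k + 1) * π := by field_simp
      simp only [phase, h1]
      push_cast
      linarith
    have hb : ((k + 1 : ℕ) : ℝ) * π ≤ phase σ L ((k + 2) * (π / L)) := by
      have h0 := (arctan_lt_pi_div_two ((k + 2) * (π / L) / -σ)).le
      have h1 : (k + 2 : ℝ) * (π / L) * L = (k + 2) * π := by field_simp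
      simp only [phase, h1]
      push_cast
      linarith
    obtain ⟨x, hx, hxe⟩ := intermediate_value_Icc hle hcont.continuousOn ⟨ha, hb⟩
    exact ⟨x, hx, hxe⟩
  choose κ hκ hκe using hex
  refine ⟨κ, ?_, hκ, ?_⟩
  · intro i j hij
    rw [← hmono.lt_iff_lt, hκe, hκe]
    have : ((i + 1 : ℕ) : ℝ) < ((j + 1 : ℕ) : ℝ) := by exact_mod_cast Nat.succ_lt_succ hij
    exact mul_lt_mul_of_pos_right this pi_pos
  · intro x hx
    rw [isLevel_sq_iff_phase hσ hL0 hx]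
    constructor
    · rintro ⟨j, hj⟩
      -- The phase starts at 0, so only `j ≥ 1` occurs; mode `k` corresponds to `j = k + 1`.
      have h0 : phase σ L 0 < phase σ L x := hmono hx
      rw [hj] at h0
      simp only [phase, zero_mul, zero_div, arctan_zero, mul_zero, sub_zero] at h0
      have hj0 : 0 < j := by
        have := pos_of_mul_pos_left h0 pi_pos.le
        exact_mod_cast this
      refine ⟨(j - 1).toNat, hmono.injective ?_⟩
      rw [hκe, hj]
      congr 1
      have : (((j - 1).toNat + 1 : ℕ) : ℤ) = j := by omega
      exact_mod_cast congrArg (Int.cast (R := ℝ)) this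
    · rintro ⟨k, rfl⟩
      exact ⟨(k + 1 : ℕ), by rw [hκe]; push_cast; ring⟩

/-! ### The negative levels -/

/-- The exponential form shows how close a root is to `-σ`. The odd condition stays hyperbolic
because the uniqueness of its root is proved in that form. -/
theorem isLevel_neg_sq_iff_exp {σ L κ : ℝ} (hL : 0 < L) (hκ : 0 < κ) :
    IsLevel σ L (-κ ^ 2) ↔
      (κ + σ) * exp (κ * L) = κ - σ ∨ κ * cosh (κ * (L / 2)) + σ * sinh (κ * (L / 2)) = 0 := by
  rw [isLevel_neg_sq_iff hL hκ]
  refine or_congr ?_ Iff.rfl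
  have h1 : exp (κ * L) = exp (κ * (L / 2)) * exp (κ * (L / 2)) := by
    rw [← exp_add]; ring_nf
  have h2 : exp (κ * (L / 2)) * exp (-(κ * (L / 2))) = 1 := by
    rw [← exp_add]; simp
  have h3 : κ * sinh (κ * (L / 2)) + σ * cosh (κ * (L / 2))
      = exp (-(κ * (L / 2))) / 2 * ((κ + σ) * exp (κ * L) - (κ - σ)) := by
    rw [sinh_eq, cosh_eq, h1]
    linear_combination (-(κ + σ) * exp (κ * (L / 2)) / 2) * h2
  rw [h3, mul_eq_zero, or_iff_right (by positivity), sub_eq_zero]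

theorem odd_condition_iff_exp {σ L κ : ℝ} :
    κ * cosh (κ * (L / 2)) + σ * sinh (κ * (L / 2)) = 0 ↔
      (-σ - κ) * exp (κ * L) = κ - σ := by
  have h1 : exp (κ * L) = exp (κ * (L / 2)) * exp (κ * (L / 2)) := by
    rw [← exp_add]; ring_nf
  have h2 : exp (κ * (L / 2)) * exp (-(κ * (L / 2))) = 1 := by
    rw [← exp_add]; simp
  have h3 : κ * cosh (κ * (L / 2)) + σ * sinh (κ * (L / 2))
      = exp (-(κ * (L / 2))) / 2 * ((κ - σ) - (-σ - κ) * exp (κ * L)) := by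
    rw [sinh_eq, cosh_eq, h1]
    linear_combination (-(κ + σ) * exp (κ * (L / 2)) / 2) * h2
  rw [h3, mul_eq_zero, or_iff_right (by positivity), sub_eq_zero, eq_comm]

/-- Every root exceeds `-σ`, and there both `(x + σ) / (x - σ)` and `exp (x * L)` increase strictly,
so their product equals 1 at most once. -/
theorem even_condition_unique {σ L x y : ℝ} (hσ : σ < 0) (hL : 0 < L) (hx : 0 < x) (hxy : x < y)
    (h1 : (x + σ) * exp (x * L) = x - σ) (h2 : (y + σ) * exp (y * L) = y - σ) : False := by
  have hxs : 0 < x + σ := by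
    have : 0 < (x + σ) * exp (x * L) := by rw [h1]; linarith
    exact pos_of_mul_pos_left this (exp_pos _).le
  have he : exp (x * L) < exp (y * L) := exp_lt_exp.2 (mul_lt_mul_of_pos_right hxy hL)
  have hp : (x + σ) * (y - σ) < (y + σ) * (x - σ) := by nlinarith
  have hq : 0 < (x + σ) * (y - σ) := mul_pos hxs (by linarith)
  have : (x + σ) * (y - σ) * exp (x * L) < (y + σ) * (x - σ) * exp (y * L) :=
    mul_lt_mul hp he.le (exp_pos _) (hq.trans hp).le
  have e1 : (x + σ) * (y - σ) * exp (x * L) = (x - σ) * (y - σ) := by rw [← h1]; ring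
  have e2 : (y + σ) * (x - σ) * exp (y * L) = (x - σ) * (y - σ) := by rw [← h2]; ring
  linarith

/-- The function also vanishes at 0, so two positive roots give, by Rolle, two positive critical
points. At a critical point `z * ℓ * tanh (z * ℓ) = -(1 + σ * ℓ)`, and the left side is strictly
increasing for `z > 0`. -/
theorem odd_condition_unique {σ ℓ x y : ℝ} (hℓ : 0 < ℓ) (hx : 0 < x) (hxy : x < y)
    (h1 : x * cosh (x * ℓ) + σ * sinh (x * ℓ) = 0)
    (h2 : y * cosh (y * ℓ) + σ * sinh (y * ℓ) = 0) : False := by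
  have hd : ∀ z, HasDerivAt (fun z => z * cosh (z * ℓ) + σ * sinh (z * ℓ))
      ((1 + σ * ℓ) * cosh (z * ℓ) + z * ℓ * sinh (z * ℓ)) z := by
    intro z
    have hi : HasDerivAt (fun z : ℝ => z * ℓ) ℓ z := by simpa using (hasDerivAt_id z).mul_const ℓ
    exact (((hasDerivAt_id z).mul hi.cosh).add (hi.sinh.const_mul σ)).congr_deriv
      (by simp only [id]; ring)
  have hc : Continuous (fun z => z * cosh (z * ℓ) + σ * sinh (z * ℓ)) :=
    continuous_iff_continuousAt.2 fun z => (hd z).continuousAt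
  obtain ⟨a, ha, hae⟩ := exists_hasDerivAt_eq_zero hx hc.continuousOn (by simp [h1])
    fun z _ => hd z
  obtain ⟨b, hb, hbe⟩ := exists_hasDerivAt_eq_zero hxy hc.continuousOn (by simp [h1, h2])
    fun z _ => hd z
  have hab : a < b := ha.2.trans hb.1
  have hs : 0 < sinh (b * ℓ - a * ℓ) :=
    sinh_pos_iff.2 (sub_pos.2 (mul_lt_mul_of_pos_right hab hℓ))
  rw [sinh_sub] at hs
  have hsa : 0 < sinh (a * ℓ) * cosh (b * ℓ) :=
    mul_pos (sinh_pos_iff.2 (mul_pos ha.1 hℓ)) (cosh_pos _)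
  have key : ℓ * (a * (sinh (a * ℓ) * cosh (b * ℓ)) - b * (sinh (b * ℓ) * cosh (a * ℓ))) = 0 := by
    linear_combination cosh (b * ℓ) * hae - cosh (a * ℓ) * hbe
  have key2 := (mul_eq_zero.1 key).resolve_left hℓ.ne'
  have : a * (sinh (a * ℓ) * cosh (b * ℓ)) < b * (sinh (b * ℓ) * cosh (a * ℓ)) :=
    mul_lt_mul hab (by linarith) hsa (ha.1.trans hab).le
  linarith

/-- The two negative levels. -/
theorem exists_negative_levels {σ L : ℝ} (hσ : σ < 0) (hL : 4 / -σ < L) :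
    ∃ a b : ℝ, 0 < b ∧ b < -σ ∧ -σ < a ∧
      a ^ 2 - σ ^ 2 ≤ 9 * σ ^ 2 * exp (σ * L / 2) ∧
      σ ^ 2 - b ^ 2 ≤ 9 * σ ^ 2 * exp (σ * L / 2) ∧
      ∀ x, 0 < x → (IsLevel σ L (-x ^ 2) ↔ x = a ∨ x = b) := by
  have hs : 0 < -σ := by linarith
  have hL0 : 0 < L := lt_trans (by positivity) hL
  have hsL : 2 < -σ * L / 2 := by
    rw [div_lt_iff₀ hs] at hL
    linarith
  -- The value 3 is what the sign changes need: at `2 * -σ` and at `-σ / 2` the linear part of the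
  -- condition has ratio 3.
  have he : 3 < exp (-σ / 2 * L) := by
    have := add_one_le_exp (-σ / 2 * L)
    linarith
  have he2 : 3 < exp (2 * -σ * L) :=
    he.trans (exp_lt_exp.2 (by nlinarith))
  obtain ⟨a, ha, hae⟩ : ∃ a ∈ Icc (-σ) (2 * -σ), (a + σ) * exp (a * L) - (a - σ) = 0 := by
    have hc : Continuous fun a => (a + σ) * exp (a * L) - (a - σ) := by fun_prop
    have := intermediate_value_Icc (show -σ ≤ 2 * -σ by linarith) hc.continuousOn
    refine this ⟨?_, ?_⟩
    · simp only [neg_add_cancel, zero_mul]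
      linarith
    · nlinarith
  obtain ⟨b, hb, hbe⟩ : ∃ b ∈ Icc (-σ / 2) (-σ), (-σ - b) * exp (b * L) - (b - σ) = 0 := by
    have hc : Continuous fun b => (-σ - b) * exp (b * L) - (b - σ) := by fun_prop
    have := intermediate_value_Icc' (show -σ / 2 ≤ -σ by linarith) hc.continuousOn
    refine this ⟨?_, ?_⟩
    · simp only [sub_self, zero_mul]
      linarith
    · nlinarith
  rw [sub_eq_zero] at hae hbe
  have ha0 : 0 < a := by linarith [ha.1]
  have hb0 : 0 < b := by linarith [hb.1]
  have hinv : ∀ z : ℝ, exp (z * L) * exp (-(z * L)) = 1 := fun z => by rw [← exp_add]; simp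
  refine ⟨a, b, hb0, ?_, ?_, ?_, ?_, ?_⟩
  · refine lt_of_le_of_ne hb.2 fun h => ?_
    rw [h] at hbe
    simp only [sub_self, zero_mul] at hbe
    linarith
  · refine lt_of_le_of_ne ha.1 fun h => ?_
    rw [← h] at hae
    simp only [neg_add_cancel, zero_mul] at hae
    linarith
  -- The characteristic equation multiplied by `(a - σ) * exp (-(a * L))`. The brackets for `a` and
  -- `b` then give the factor 9 and the common rate `-σ / 2`.
  · have h1 : a ^ 2 - σ ^ 2 = (a - σ) ^ 2 * exp (-(a * L)) := by
      linear_combination (a - σ) * exp (-(a * L)) * hae - (a ^ 2 - σ ^ 2) * hinv a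
    rw [h1]
    refine mul_le_mul ?_ (exp_le_exp.2 ?_) (exp_pos _).le (by positivity)
    · nlinarith [ha.1, ha.2]
    · nlinarith [ha.1]
  · have h1 : σ ^ 2 - b ^ 2 = (b - σ) ^ 2 * exp (-(b * L)) := by
      linear_combination (b - σ) * exp (-(b * L)) * hbe - (σ ^ 2 - b ^ 2) * hinv b
    rw [h1]
    refine mul_le_mul ?_ (exp_le_exp.2 ?_) (exp_pos _).le (by positivity)
    · nlinarith [hb.1, hb.2]
    · nlinarith [hb.1]
  · intro x hx
    rw [isLevel_neg_sq_iff_exp hL0 hx]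
    refine or_congr ⟨fun h => ?_, fun h => h ▸ hae⟩
      ⟨fun h => ?_, fun h => odd_condition_iff_exp.2 (h ▸ hbe)⟩
    · rcases lt_trichotomy x a with hlt | heq | hgt
      · exact (even_condition_unique hσ hL0 hx hlt h hae).elim
      · exact heq
      · exact (even_condition_unique hσ hL0 ha0 hgt hae h).elim
    · have hb' := odd_condition_iff_exp.2 hbe
      rcases lt_trichotomy x b with hlt | heq | hgt
      · exact (odd_condition_unique (half_pos hL0) hx hlt h hb').elim
      · exact heq
      · exact (odd_condition_unique (half_pos hL0) hb0 hgt hb' h).elim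

/-! ### The levels in increasing order -/

/-- The infima defining `level` have a spectral meaning only when they are attained. A strictly
increasing enumeration of the spectrum makes each of them a minimum. -/
theorem level_eq_of_strictMono {σ L : ℝ} {E : ℕ → ℝ} (hE : StrictMono E)
    (h : ∀ e, IsLevel σ L e ↔ ∃ k, E k = e) (k : ℕ) : level σ L k = E k := by
  induction k with
  | zero =>
    rw [level]
    refine IsLeast.csInf_eq ⟨(h _).2 ⟨0, rfl⟩, ?_⟩
    rintro e he
    obtain ⟨j, rfl⟩ := (h e).1 he
    exact hE.monotone (Nat.zero_le j)
  | succ k ih =>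
    rw [level, ih]
    refine IsLeast.csInf_eq ⟨⟨(h _).2 ⟨k + 1, rfl⟩, hE k.lt_succ_self⟩, ?_⟩
    rintro e ⟨he, hlt⟩
    obtain ⟨j, rfl⟩ := (h e).1 he
    exact hE.monotone (Nat.succ_le_of_lt (hE.lt_iff_lt.1 hlt))

/-- The location of the levels for large `L`. -/
theorem level_bounds {σ L : ℝ} (hσ : σ < 0) (hL : 4 / -σ < L) :
    (-σ ^ 2 - 9 * σ ^ 2 * exp (σ * L / 2) ≤ level σ L 0 ∧ level σ L 0 ≤ -σ ^ 2) ∧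
    (-σ ^ 2 ≤ level σ L 1 ∧ level σ L 1 ≤ -σ ^ 2 + 9 * σ ^ 2 * exp (σ * L / 2)) ∧
    ∀ k : ℕ, ((k + 1) * (π / L)) ^ 2 ≤ level σ L (k + 2) ∧
      level σ L (k + 2) ≤ ((k + 2) * (π / L)) ^ 2 := by
  have hs : 0 < -σ := by linarith
  have hL2 : 2 / -σ < L := lt_of_le_of_lt (div_le_div_of_nonneg_right (by norm_num) hs.le) hL
  have hL0 : 0 < L := lt_trans (by positivity) hL
  obtain ⟨a, b, hb0, hbs, hsa, ha, hb, hneg⟩ := exists_negative_levels hσ hL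
  obtain ⟨κ, hκm, hκ, hpos⟩ := exists_positive_levels hσ hL2
  have hκ0 : ∀ k, 0 < κ k := fun k => lt_of_lt_of_le (by positivity) (hκ k).1
  let E : ℕ → ℝ := fun k => match k with
    | 0 => -a ^ 2
    | 1 => -b ^ 2
    | k + 2 => κ k ^ 2
  have hE : StrictMono E := by
    refine strictMono_nat_of_lt_succ fun k => ?_
    match k with
    | 0 =>
      change -a ^ 2 < -b ^ 2
      nlinarith
    | 1 =>
      change -b ^ 2 < κ 0 ^ 2
      nlinarith [hκ0 0]
    | k + 2 => exact pow_lt_pow_left₀ (hκm k.lt_succ_self) (hκ0 k).le two_ne_zero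
  have hlev : ∀ e, IsLevel σ L e ↔ ∃ k, E k = e := by
    intro e
    rcases lt_trichotomy e 0 with he | he | he
    · have hx : 0 < √(-e) := sqrt_pos.2 (by linarith)
      have hex : e = -√(-e) ^ 2 := by rw [sq_sqrt (by linarith)]; ring
      constructor
      · intro h
        rw [hex] at h
        rcases (hneg _ hx).1 h with h | h
        · exact ⟨0, by rw [hex, h]⟩
        · exact ⟨1, by rw [hex, h]⟩
      · rintro ⟨k, rfl⟩
        match k, he with
        | 0, _ => exact (hneg a (by linarith)).2 (Or.inl rfl)
        | 1, _ => exact (hneg b hb0).2 (Or.inr rfl)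
        | k + 2, he => exact absurd he (not_lt.2 (sq_nonneg (κ k)))
    · subst he
      rw [isLevel_zero_iff hL0]
      constructor
      · rintro (h | h)
        · linarith
        · rw [div_lt_iff₀ hs] at hL2
          nlinarith
      · rintro ⟨k, hk⟩
        match k, hk with
        | 0, hk => nlinarith [show -a ^ 2 = (0 : ℝ) from hk]
        | 1, hk => nlinarith [show -b ^ 2 = (0 : ℝ) from hk]
        | k + 2, hk => exact absurd (show κ k ^ 2 = 0 from hk) (pow_pos (hκ0 k) 2).ne'
    · have hx : 0 < √e := sqrt_pos.2 he
      have hex : e = √e ^ 2 := (sq_sqrt he.le).symm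
      constructor
      · intro h
        rw [hex] at h
        obtain ⟨k, hk⟩ := (hpos _ hx).1 h
        exact ⟨k + 2, by rw [hex, ← hk]⟩
      · rintro ⟨k, rfl⟩
        match k, he with
        | 0, he => exact absurd (show 0 < -a ^ 2 from he) (by nlinarith)
        | 1, he => exact absurd (show 0 < -b ^ 2 from he) (by nlinarith)
        | k + 2, _ => exact (hpos _ (hκ0 k)).2 ⟨k, rfl⟩
  simp only [level_eq_of_strictMono hE hlev]
  refine ⟨⟨?_, ?_⟩, ⟨?_, ?_⟩, fun k => ⟨?_, ?_⟩⟩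
  · change _ ≤ -a ^ 2
    linarith
  · change -a ^ 2 ≤ _
    nlinarith
  · change _ ≤ -b ^ 2
    nlinarith
  · change -b ^ 2 ≤ _
    linarith
  · exact pow_le_pow_left₀ (by positivity) (hκ k).1 2
  · exact pow_le_pow_left₀ (hκ0 k).le (hκ k).2 2

/-! ### Product weights on occupation numbers -/

/-- The product weight `∏_k t_k ^ n_k`. -/
def weight (t : ℕ → ℝ) (n : Occ) : ℝ := n.prod fun k m => t k ^ m

/-- The linear functional `∑_k c_k n_k`. -/
def count (c : ℕ → ℝ) (n : Occ) : ℝ := n.sum fun k m => c k * m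

/-- The mean occupation number `t / (1 - t)` of a mode with weight `t`. -/
def occupation (t : ℝ) : ℝ := t / (1 - t)

theorem weight_add_single (t : ℕ → ℝ) (n : Occ) (k : ℕ) :
    weight t (n + Finsupp.single k 1) = t k * weight t n := by
  rw [weight, Finsupp.prod_add_index' (by simp) (by intro a b c; exact pow_add _ _ _),
    Finsupp.prod_single_index (by simp), pow_one, mul_comm, weight]

theorem count_add_single (c : ℕ → ℝ) (n : Occ) (k : ℕ) :
    count c (n + Finsupp.single k 1) = count c n + c k := by
  rw [count, Finsupp.sum_add_index' (by simp) (by intro a b d; push_cast; ring),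
    Finsupp.sum_single_index (by simp), count]
  simp

theorem weight_nonneg {t : ℕ → ℝ} (ht : ∀ k, 0 ≤ t k) (n : Occ) : 0 ≤ weight t n :=
  Finset.prod_nonneg fun k _ => pow_nonneg (ht k) _

theorem weight_zero (t : ℕ → ℝ) : weight t 0 = 1 := Finsupp.prod_zero_index

theorem count_nonneg {c : ℕ → ℝ} (hc : ∀ k, 0 ≤ c k) (n : Occ) : 0 ≤ count c n :=
  Finset.sum_nonneg fun k _ => mul_nonneg (hc k) (Nat.cast_nonneg _)

theorem count_mono {c d : ℕ → ℝ} (h : ∀ k, c k ≤ d k) (n : Occ) : count c n ≤ count d n :=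
  Finset.sum_le_sum fun k _ => mul_le_mul_of_nonneg_right (h k) (Nat.cast_nonneg _)

theorem count_one (n : Occ) : count (fun _ => 1) n = ((n.sum fun _ m => m : ℕ) : ℝ) := by
  simp [count, Finsupp.sum]

theorem hasSum_count (c : ℕ → ℝ) (n : Occ) : HasSum (fun k => c k * n k) (count c n) := by
  refine hasSum_sum_of_ne_finset_zero fun k hk => ?_
  simp [Finsupp.notMem_support_iff.1 hk]

theorem exp_neg_count (x : ℕ → ℝ) (n : Occ) :
    exp (-count x n) = weight (fun k => exp (-x k)) n := by
  rw [count, weight, Finsupp.sum, Finsupp.prod, ← Finset.sum_neg_distrib, exp_sum]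
  refine Finset.prod_congr rfl fun k _ => ?_
  rw [← exp_nat_mul]
  ring_nf

theorem occupation_nonneg {t : ℝ} (h0 : 0 ≤ t) (h1 : t < 1) : 0 ≤ occupation t :=
  div_nonneg h0 (by linarith)

/-- Solves the fixed-point equation that `tsum_shift` produces for a moment linear in `n k`. -/
theorem occupation_eq_iff {t a z : ℝ} (h1 : t < 1) : a = t * (a + z) ↔ a = occupation t * z := by
  have h : 1 - t ≠ 0 := by linarith
  rw [occupation, div_mul_eq_mul_div, eq_div_iff h]
  constructor <;> intro h <;> linear_combination h

theorem summable_occupation {t : ℕ → ℝ} {q : ℝ} (h0 : ∀ k, 0 ≤ t k) (hq : q < 1)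
    (htq : ∀ k, t k ≤ q) (ht : Summable t) : Summable fun k => occupation (t k) := by
  refine Summable.of_nonneg_of_le (fun k => occupation_nonneg (h0 k) ((htq k).trans_lt hq))
    (fun k => ?_) (ht.div_const (1 - q))
  exact div_le_div_of_nonneg_left (h0 k) (by linarith) (by linarith [htq k])

/-- Any finite set of configurations sits in a box of finitely many modes and bounded occupations.
There the sum factorizes into geometric series, each at most `1 + occupation (t k) ≤ exp (occupation
(t k))`. -/
theorem summable_weight {t : ℕ → ℝ} {q : ℝ} (h0 : ∀ k, 0 ≤ t k) (hq : q < 1)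
    (htq : ∀ k, t k ≤ q) (ht : Summable t) : Summable (weight t) := by
  have hocc := summable_occupation h0 hq htq ht
  have h1 : ∀ k, t k < 1 := fun k => (htq k).trans_lt hq
  refine summable_of_sum_le (c := exp (∑' k, occupation (t k))) (weight_nonneg h0) fun S => ?_
  let s : Finset ℕ := S.biUnion fun n => n.support
  let M : ℕ := S.sup fun n => n.support.sup n + 1
  have hsub : S ⊆ s.finsupp fun _ => Finset.range M := by
    intro n hn
    rw [Finset.mem_finsupp_iff]
    refine ⟨Finset.subset_biUnion_of_mem (fun n : Occ => n.support) hn, fun i _ => ?_⟩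
    rw [Finset.mem_range]
    have h2 : n.support.sup n + 1 ≤ M := Finset.le_sup (f := fun n : Occ => n.support.sup n + 1) hn
    by_cases hi : i ∈ n.support
    · have : n i ≤ n.support.sup n := Finset.le_sup hi
      omega
    · rw [Finsupp.notMem_support_iff.1 hi]
      omega
  calc ∑ n ∈ S, weight t n
      ≤ ∑ n ∈ s.finsupp fun _ => Finset.range M, weight t n :=
        Finset.sum_le_sum_of_subset_of_nonneg hsub fun n _ _ => weight_nonneg h0 n
    _ = ∏ k ∈ s, ∑ m ∈ Finset.range M, t k ^ m := by
        rw [Finset.prod_sum, Finset.finsupp, Finset.sum_map]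
        refine Finset.sum_congr (by congr!) fun p _ => ?_
        simp only [Function.Embedding.coeFn_mk, weight]
        rw [Finsupp.prod_of_support_subset _ (Finsupp.support_indicator_subset s p) _ (by simp),
          ← Finset.prod_attach]
        refine Finset.prod_congr rfl fun k _ => ?_
        rw [Finsupp.indicator_of_mem k.2]
    _ ≤ ∏ k ∈ s, exp (occupation (t k)) := by
        refine Finset.prod_le_prod (fun k _ => Finset.sum_nonneg fun m _ => pow_nonneg (h0 k) m)
          fun k _ => ?_
        have h3 : ∑ m ∈ Finset.range M, t k ^ m ≤ (1 - t k)⁻¹ := by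
          rw [← tsum_geometric_of_lt_one (h0 k) (h1 k)]
          exact (summable_geometric_of_lt_one (h0 k) (h1 k)).sum_le_tsum _
            fun m _ => pow_nonneg (h0 k) m
        have h4 : (1 - t k)⁻¹ = occupation (t k) + 1 := by
          have : 1 - t k ≠ 0 := by linarith [h1 k]
          rw [occupation]
          field_simp
          ring
        exact h3.trans (h4.le.trans (add_one_le_exp _))
    _ = exp (∑ k ∈ s, occupation (t k)) := (exp_sum _ _).symm
    _ ≤ _ := exp_le_exp.2 (hocc.sum_le_tsum _ fun k _ => occupation_nonneg (h0 k) (h1 k))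

/-- With `p` strictly between `q` and 1, a factor `p` per particle is split off the weight. It
absorbs the polynomial, and the weights `t k / p` are still uniformly below 1. -/
theorem summable_sq_mul_weight {t : ℕ → ℝ} {q : ℝ} (h0 : ∀ k, 0 ≤ t k) (hq0 : 0 ≤ q) (hq : q < 1)
    (htq : ∀ k, t k ≤ q) (ht : Summable t) :
    Summable fun n => (count (fun _ => 1) n + 1) ^ 2 * weight t n := by
  set p : ℝ := (1 + q) / 2 with hp
  have hp0 : 0 < p := by linarith
  have hp1 : p < 1 := by linarith
  have hW : Summable (weight fun k => t k / p) := by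
    refine summable_weight (q := q / p) (fun k => div_nonneg (h0 k) hp0.le) ?_
      (fun k => div_le_div_of_nonneg_right (htq k) hp0.le) (ht.div_const p)
    rw [div_lt_one hp0]
    linarith
  have hfac : ∀ n : Occ, weight t n = p ^ (n.sum fun _ m => m) * weight (fun k => t k / p) n := by
    intro n
    rw [weight, weight, Finsupp.sum, ← Finset.prod_pow_eq_pow_sum, Finsupp.prod, Finsupp.prod,
      ← Finset.prod_mul_distrib]
    refine Finset.prod_congr rfl fun k _ => ?_
    rw [← mul_pow]
    congr 1
    field_simp
  obtain ⟨B, hB⟩ : ∃ B : ℝ, ∀ m : ℕ, ((m : ℝ) + 1) ^ 2 * p ^ m ≤ B := by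
    have hl := (tendsto_pow_const_mul_const_pow_of_lt_one 2 hp0.le hp1).comp (tendsto_add_atTop_nat 1)
    obtain ⟨B, hB⟩ := hl.bddAbove_range
    refine ⟨B / p, fun m => ?_⟩
    have := hB ⟨m, rfl⟩
    rw [le_div_iff₀ hp0]
    simp only [Function.comp_apply, Nat.cast_add, Nat.cast_one, pow_succ p m] at this
    linarith
  refine Summable.of_nonneg_of_le (fun n => mul_nonneg (sq_nonneg _) (weight_nonneg h0 n))
    (fun n => ?_) (hW.mul_left B)
  rw [count_one, hfac, ← mul_assoc]
  exact mul_le_mul_of_nonneg_right (hB _) (weight_nonneg (fun k => div_nonneg (h0 k) hp0.le) n)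

/-- Adding one particle to the mode `k`. -/
theorem tsum_shift (t : ℕ → ℝ) (g : Occ → ℝ) (k : ℕ) :
    ∑' n : Occ, n k * (g n * weight t n) =
      t k * ∑' n : Occ, (n k + 1) * (g (n + Finsupp.single k 1) * weight t n) := by
  have hinj : Function.Injective fun n : Occ => n + Finsupp.single k 1 := add_left_injective _
  rw [← hinj.tsum_eq (f := fun n : Occ => n k * (g n * weight t n)), ← tsum_mul_left]
  · refine tsum_congr fun n => ?_
    rw [weight_add_single, Finsupp.add_apply, Finsupp.single_eq_same]
    push_cast
    ring
  · intro n hn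
    have hk : n k ≠ 0 := fun h => hn (by simp [h])
    refine ⟨n - Finsupp.single k 1, tsub_add_cancel_of_le ?_⟩
    exact Finsupp.single_le_iff.2 (Nat.one_le_iff_ne_zero.2 hk)

theorem hasSum_count_mul {c : ℕ → ℝ} (hc : ∀ k, 0 ≤ c k) {g : Occ → ℝ} (hg : ∀ n, 0 ≤ g n)
    (hs : Summable fun n => count c n * g n) :
    HasSum (fun k => c k * ∑' n : Occ, n k * g n) (∑' n, count c n * g n) := by
  let f : Occ × ℕ → ℝ := fun x => c x.2 * x.1 x.2 * g x.1
  have hrow : ∀ n, HasSum (fun k => f (n, k)) (count c n * g n) := fun n =>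
    (hasSum_count c n).mul_right (g n)
  have hf : Summable f := by
    rw [summable_prod_of_nonneg fun x => mul_nonneg (mul_nonneg (hc _) (Nat.cast_nonneg _)) (hg _)]
    exact ⟨fun n => (hrow n).summable, hs.congr fun n => (hrow n).tsum_eq.symm⟩
  have h1 := hf.prod_symm.prod
  have h2 : ∑' k, ∑' n, f (n, k) = ∑' n, count c n * g n := by
    rw [hf.tsum_comm]
    exact tsum_congr fun n => (hrow n).tsum_eq
  have h3 : ∀ k, ∑' n, f (n, k) = c k * ∑' n : Occ, n k * g n := fun k => by
    rw [← tsum_mul_left]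
    exact tsum_congr fun n => mul_assoc _ _ _
  rw [← h2]
  simp only [← h3]
  exact h1.hasSum

/-- The first and second moments of `∑_k c_k n_k` for the product weight. -/
theorem moments {t c : ℕ → ℝ} {q : ℝ} (h0 : ∀ k, 0 ≤ t k) (hq0 : 0 ≤ q) (hq : q < 1)
    (htq : ∀ k, t k ≤ q) (ht : Summable t) (hc0 : ∀ k, 0 ≤ c k) (hc1 : ∀ k, c k ≤ 1) :
    (∑' n, count c n * weight t n = (∑' k, c k * occupation (t k)) * ∑' n, weight t n) ∧
    ∑' n, count c n ^ 2 * weight t n =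
      ((∑' k, c k * occupation (t k)) ^ 2 +
        ∑' k, c k ^ 2 * (occupation (t k) * (1 + occupation (t k)))) * ∑' n, weight t n := by
  have h1 : ∀ k, t k < 1 := fun k => (htq k).trans_lt hq
  have hW := weight_nonneg h0
  have hN : ∀ n : Occ, 0 ≤ count (fun _ => 1) n := count_nonneg fun _ => zero_le_one
  have hC : ∀ n : Occ, 0 ≤ count c n := count_nonneg hc0
  have hCN : ∀ n : Occ, count c n ≤ count (fun _ => 1) n := count_mono hc1
  have hnN : ∀ (n : Occ) k, (n k : ℝ) ≤ count (fun _ => 1) n := fun n k => by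
    have := (hasSum_count (fun _ => 1) n).summable.le_tsum k fun j _ => by positivity
    rwa [(hasSum_count (fun _ => 1) n).tsum_eq, one_mul] at this
  have hdom : ∀ g : Occ → ℝ, (∀ n, 0 ≤ g n) → (∀ n, g n ≤ (count (fun _ => 1) n + 1) ^ 2) →
      Summable fun n => g n * weight t n := fun g hg0 hg =>
    Summable.of_nonneg_of_le (fun n => mul_nonneg (hg0 n) (hW n))
      (fun n => mul_le_mul_of_nonneg_right (hg n) (hW n))
      (summable_sq_mul_weight h0 hq0 hq htq ht)
  have s1 : Summable (weight t) := summable_weight h0 hq htq ht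
  have sC : Summable fun n => count c n * weight t n :=
    hdom _ hC fun n => by nlinarith [hN n, hCN n]
  have sk : ∀ k, Summable fun n : Occ => (n k : ℝ) * weight t n := fun k =>
    hdom _ (fun n => Nat.cast_nonneg _) fun n => by nlinarith [hN n, hnN n k]
  have skC : ∀ k, Summable fun n : Occ => (n k : ℝ) * (count c n * weight t n) := fun k => by
    simp only [← mul_assoc]
    refine hdom _ (fun n => mul_nonneg (Nat.cast_nonneg _) (hC n)) fun n => ?_
    have := mul_le_mul (hnN n k) (hCN n) (hC n) (hN n)
    nlinarith [hN n]
  have sCC : Summable fun n => count c n * (count c n * weight t n) := by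
    simp only [← mul_assoc]
    refine hdom _ (fun n => mul_nonneg (hC n) (hC n)) fun n => ?_
    have := mul_le_mul (hCN n) (hCN n) (hC n) (hN n)
    nlinarith [hN n]
  set Z := ∑' n, weight t n with hZ
  set M := ∑' n, count c n * weight t n with hM
  -- Shifting with `g = 1` reads `A = t k * (A + Z)` for the first moment `A` of `n k`.
  have eA : ∀ k, ∑' n : Occ, (n k : ℝ) * weight t n = occupation (t k) * Z := fun k => by
    refine (occupation_eq_iff (h1 k)).1 ?_
    have := tsum_shift t (fun _ => 1) k
    simp only [one_mul, add_mul] at this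
    rw [(sk k).tsum_add s1] at this
    exact this
  have hM1 : HasSum (fun k => c k * (occupation (t k) * Z)) M := by
    simpa only [eA] using hasSum_count_mul hc0 hW sC
  have sR : Summable fun k => c k * occupation (t k) := by
    refine Summable.of_nonneg_of_le
      (fun k => mul_nonneg (hc0 k) (occupation_nonneg (h0 k) (h1 k)))
      (fun k => mul_le_of_le_one_left (occupation_nonneg (h0 k) (h1 k)) (hc1 k))
      (summable_occupation h0 hq htq ht)
  have hM2 : M = (∑' k, c k * occupation (t k)) * Z := by
    rw [← tsum_mul_right, ← hM1.tsum_eq]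
    exact tsum_congr fun k => by ring
  refine ⟨hM2, ?_⟩
  -- The extra particle raises `count c` by `c k`; this is the source of the variance term.
  have eB : ∀ k, ∑' n : Occ, (n k : ℝ) * (count c n * weight t n) =
      occupation (t k) * (c k * (occupation (t k) * Z) + M + c k * Z) := fun k => by
    refine (occupation_eq_iff (h1 k)).1 ?_
    refine (tsum_shift t (count c) k).trans (congrArg (t k * ·) ?_)
    have e : ∀ n : Occ, ((n k : ℝ) + 1) * (count c (n + Finsupp.single k 1) * weight t n) =
        (n k : ℝ) * (count c n * weight t n) + (c k * ((n k : ℝ) * weight t n) +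
          count c n * weight t n + c k * weight t n) := fun n => by
      rw [count_add_single]; ring
    simp only [e]
    rw [(skC k).tsum_add ((((sk k).mul_left _).add sC).add (s1.mul_left _)),
      (((sk k).mul_left _).add sC).tsum_add (s1.mul_left _),
      ((sk k).mul_left _).tsum_add sC, tsum_mul_left, tsum_mul_left, eA]
  have hQ := hasSum_count_mul hc0 (fun n => mul_nonneg (hC n) (hW n)) sCC
  simp only [eB] at hQ
  -- Removing the product of means leaves exactly the variance series, whose summability comes for
  -- free.
  have hQ1 : HasSum (fun k => c k * occupation (t k) * M)
      ((∑' k, c k * occupation (t k)) * M) := sR.hasSum.mul_right M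
  have hQ2 := hQ.sub hQ1
  have hQ3 : ∑' k, c k ^ 2 * (occupation (t k) * (1 + occupation (t k))) * Z
      = (∑' n, count c n * (count c n * weight t n)) - (∑' k, c k * occupation (t k)) * M := by
    rw [← hQ2.tsum_eq]
    exact tsum_congr fun k => by ring
  rw [tsum_mul_right] at hQ3
  have e2 : ∀ n, count c n ^ 2 * weight t n = count c n * (count c n * weight t n) := fun n => by
    ring
  simp only [e2]
  linear_combination (-1 : ℝ) * hQ3 + (∑' k, c k * occupation (t k)) * hM2

open MeasureTheory

/-! ### The density of the free gas -/

/-- The Bose occupation number of a mode of energy `e`. -/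
def boseFactor (β α e : ℝ) : ℝ := occupation (exp (-β * (e - α)))

/-- The limiting density of the free gas at chemical potential `α`. -/
def freeDensity (β α : ℝ) : ℝ := π⁻¹ * ∫ p in Ioi (0 : ℝ), boseFactor β α (p ^ 2)

theorem occupation_mono {s t : ℝ} (h0 : 0 ≤ s) (hst : s ≤ t) (h1 : t < 1) :
    occupation s ≤ occupation t :=
  div_le_div₀ (h0.trans hst) hst (by linarith) (by linarith)

theorem boseWeight_lt_one {β α e : ℝ} (hβ : 0 < β) (he : α < e) : exp (-β * (e - α)) < 1 := by
  rw [exp_lt_one_iff]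
  have := mul_pos hβ (sub_pos.2 he)
  linarith

theorem boseFactor_nonneg {β α e : ℝ} (hβ : 0 < β) (he : α < e) : 0 ≤ boseFactor β α e :=
  occupation_nonneg (exp_pos _).le (boseWeight_lt_one hβ he)

theorem boseFactor_anti {β α e e' : ℝ} (hβ : 0 < β) (he : α < e) (h : e ≤ e') :
    boseFactor β α e' ≤ boseFactor β α e :=
  occupation_mono (exp_pos _).le (exp_le_exp.2 (by nlinarith)) (boseWeight_lt_one hβ he)

theorem boseFactor_mono {β α α' e : ℝ} (hβ : 0 < β) (he : α' < e) (h : α ≤ α') :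
    boseFactor β α e ≤ boseFactor β α' e :=
  occupation_mono (exp_pos _).le (exp_le_exp.2 (by nlinarith)) (boseWeight_lt_one hβ he)

theorem measurable_boseFactor (β α : ℝ) : Measurable fun p : ℝ => boseFactor β α (p ^ 2) := by
  unfold boseFactor occupation
  fun_prop

/-- For `α < 0` the Bose denominator is bounded below uniformly in `p`, so a Gaussian dominates. -/
theorem integrableOn_boseFactor {β α : ℝ} (hβ : 0 < β) (hα : α < 0) :
    IntegrableOn (fun p : ℝ => boseFactor β α (p ^ 2)) (Ioi 0) := by
  have h1 := boseWeight_lt_one hβ hα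
  have hg : Integrable fun p : ℝ => exp (-β * p ^ 2) * (1 - exp (-β * (0 - α)))⁻¹ :=
    (integrable_exp_neg_mul_sq hβ).mul_const _
  refine hg.integrableOn.mono' (measurable_boseFactor β α).aestronglyMeasurable
    (Eventually.of_forall fun p => ?_)
  have hp : α < p ^ 2 := hα.trans_le (sq_nonneg p)
  rw [norm_of_nonneg (boseFactor_nonneg hβ hp), boseFactor, occupation, div_eq_mul_inv]
  have h2 : exp (-β * (p ^ 2 - α)) ≤ exp (-β * (0 - α)) := exp_le_exp.2 (by nlinarith [sq_nonneg p])
  refine mul_le_mul (exp_le_exp.2 (by nlinarith)) (inv_anti₀ (by linarith) (by linarith))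
    (inv_nonneg.2 (by linarith)) (exp_pos _).le

theorem freeDensity_nonneg {β α : ℝ} (hβ : 0 < β) (hα : α < 0) : 0 ≤ freeDensity β α :=
  mul_nonneg (inv_nonneg.2 pi_pos.le) (integral_nonneg fun p =>
    boseFactor_nonneg hβ (hα.trans_le (sq_nonneg p)))

theorem freeDensity_mono {β α α' : ℝ} (hβ : 0 < β) (hα : α' < 0) (h : α ≤ α') :
    freeDensity β α ≤ freeDensity β α' :=
  mul_le_mul_of_nonneg_left (integral_mono (integrableOn_boseFactor hβ (h.trans_lt hα))
    (integrableOn_boseFactor hβ hα) fun p => boseFactor_mono hβ (hα.trans_le (sq_nonneg p)) h)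
    (inv_nonneg.2 pi_pos.le)

theorem continuousOn_freeDensity {β m : ℝ} (hβ : 0 < β) (hm : m < 0) :
    ContinuousOn (freeDensity β) (Iic m) := by
  refine ContinuousOn.mul continuousOn_const ?_
  refine continuousOn_of_dominated (bound := fun p => boseFactor β m (p ^ 2))
    (fun α _ => (measurable_boseFactor β α).aestronglyMeasurable)
    (fun α hα => Eventually.of_forall fun p => ?_) (integrableOn_boseFactor hβ hm)
    (Eventually.of_forall fun p => ?_)
  · have hp : m < p ^ 2 := hm.trans_le (sq_nonneg p)
    rw [norm_of_nonneg (boseFactor_nonneg hβ (lt_of_le_of_lt hα hp))]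
    exact boseFactor_mono hβ hp hα
  · unfold boseFactor occupation
    refine ContinuousOn.div (by fun_prop) (by fun_prop) fun α hα => ?_
    have := boseWeight_lt_one hβ (lt_of_le_of_lt (mem_Iic.1 hα) (hm.trans_le (sq_nonneg p)))
    exact (sub_pos.2 this).ne'

/-- The self-consistent chemical potential of the free gas. -/
theorem exists_selfConsistent {β lam m : ℝ} (hβ : 0 < β) (hlam : 0 < lam) (hm : m < 0) :
    ∃ α < 0, α + lam * freeDensity β α = m := by
  set K := lam * freeDensity β m with hK
  have hK0 : 0 ≤ K := mul_nonneg hlam.le (freeDensity_nonneg hβ hm)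
  have hc : ContinuousOn (fun α => α + lam * freeDensity β α) (Icc (m - K) m) :=
    continuousOn_id.add (continuousOn_const.mul
      ((continuousOn_freeDensity hβ hm).mono fun x hx => hx.2))
  -- At `m` the value is at least `m` since the density is nonnegative; at `m - K` monotonicity of
  -- the density makes it at most `m`.
  obtain ⟨α, hα, h⟩ := intermediate_value_Icc (by linarith : m - K ≤ m) hc (show m ∈ _ from ⟨by
      have := mul_le_mul_of_nonneg_left (freeDensity_mono hβ hm (by linarith : m - K ≤ m)) hlam.le
      linarith, by linarith⟩)
  exact ⟨α, hα.2.trans_lt hm, h⟩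

/-- Comparison of a sum with the integral of an antitone function. -/
theorem riemann_sum_bounds {f : ℝ → ℝ} (hf : AntitoneOn f (Ici 0)) (hf0 : ∀ x, 0 ≤ f x)
    (hint : IntegrableOn f (Ioi 0)) {h : ℝ} (hh : 0 < h) {g : ℕ → ℝ}
    (hg : ∀ k : ℕ, f ((k + 2) * h) ≤ g k ∧ g k ≤ f ((k + 1) * h)) :
    Summable g ∧ h * ∑' k, g k ≤ ∫ x in Ioi 0, f x ∧
      (∫ x in Ioi 0, f x) - 2 * h * f 0 ≤ h * ∑' k, g k := by
  set I := ∫ x in Ioi 0, f x with hI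
  let F : ℝ → ℝ := fun x => f (h * x)
  have hFI : ∫ x in Ioi 0, F x = h⁻¹ * I := by
    have := integral_comp_mul_left_Ioi f 0 hh
    rw [mul_zero, smul_eq_mul] at this
    exact this
  have hFint : IntegrableOn F (Ioi 0) := by
    rw [integrableOn_Ioi_comp_mul_left_iff f 0 hh, mul_zero]
    exact hint
  have hF : AntitoneOn F (Ici 0) := fun x hx y hy hxy =>
    hf (mul_nonneg hh.le hx) (mul_nonneg hh.le hy) (mul_le_mul_of_nonneg_left hxy hh.le)
  have hF0 : ∀ x, 0 ≤ F x := fun x => hf0 _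
  have hlim : Tendsto (fun n : ℕ => ∫ x in (0 : ℝ)..n, F x) atTop (𝓝 (h⁻¹ * I)) := by
    rw [← hFI]
    exact intervalIntegral_tendsto_integral_Ioi 0 hFint tendsto_natCast_atTop_atTop
  have hle : ∀ n : ℕ, ∫ x in (0 : ℝ)..n, F x ≤ h⁻¹ * I := fun n => by
    rw [← hFI, intervalIntegral.integral_of_le (Nat.cast_nonneg n)]
    exact setIntegral_mono_set hFint (Eventually.of_forall hF0) Ioc_subset_Ioi_self.eventuallyLE
  have hup : ∀ n : ℕ, ∑ i ∈ Finset.range n, F ((i : ℝ) + 1) ≤ h⁻¹ * I := fun n => by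
    have := AntitoneOn.sum_le_integral (x₀ := 0) (a := n) (f := F)
      (hF.mono fun x hx => hx.1)
    simp only [zero_add, Nat.cast_add, Nat.cast_one] at this
    exact this.trans (hle n)
  have s1 : Summable fun i : ℕ => F ((i : ℝ) + 1) :=
    summable_of_sum_range_le (fun _ => hF0 _) hup
  have s0 : Summable fun i : ℕ => F (i : ℝ) := by
    refine (summable_nat_add_iff 1).1 ?_
    simpa using s1
  have hlow : h⁻¹ * I ≤ ∑' i : ℕ, F (i : ℝ) := by
    refine le_of_tendsto hlim (Eventually.of_forall fun n => ?_)
    have := AntitoneOn.integral_le_sum (x₀ := 0) (a := n) (f := F)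
      (hF.mono fun x hx => hx.1)
    simp only [zero_add] at this
    exact this.trans (s0.sum_le_tsum _ fun _ _ => hF0 _)
  have s2 : Summable fun i : ℕ => F ((i : ℝ) + 2) := by
    have := (summable_nat_add_iff 2).2 s0
    simpa using this
  have hg1 : ∀ k : ℕ, g k ≤ F ((k : ℝ) + 1) := fun k => by
    simpa only [F, mul_comm h] using (hg k).2
  have hg2 : ∀ k : ℕ, F ((k : ℝ) + 2) ≤ g k := fun k => by
    simpa only [F, mul_comm h] using (hg k).1
  have sg : Summable g := Summable.of_nonneg_of_le (fun k => (hF0 _).trans (hg2 k)) hg1 s1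
  have b1 : ∑' k, g k ≤ h⁻¹ * I :=
    (sg.tsum_le_tsum hg1 s1).trans (s1.tsum_le_of_sum_range_le hup)
  -- Since `g k` is bounded below only by `F (k + 2)`, the terms `F 0` and `F 1` are lost, each at
  -- most `f 0`.
  have b2 : h⁻¹ * I ≤ 2 * f 0 + ∑' k, g k := by
    have e := s0.sum_add_tsum_nat_add 2
    simp only [Finset.sum_range_succ, Finset.sum_range_zero, Nat.cast_zero, Nat.cast_one,
      Nat.cast_add, Nat.cast_ofNat, zero_add] at e
    have e0 : F 0 = f 0 := by simp [F]
    have e1 : F 1 ≤ F 0 := hF (mem_Ici.2 le_rfl) (mem_Ici.2 zero_le_one) zero_le_one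
    have e2 := s2.tsum_le_tsum hg2 sg
    linarith
  refine ⟨sg, ?_, ?_⟩
  · rwa [le_inv_mul_iff₀ hh] at b1
  · rw [inv_mul_le_iff₀ hh] at b2
    linarith

/-- The free density in a finite box, up to a boundary error. -/
theorem boseFactor_sum_bounds {β α L : ℝ} (hβ : 0 < β) (hα : α < 0) (hL : 0 < L) {e : ℕ → ℝ}
    (he : ∀ k : ℕ, ((k + 1) * (π / L)) ^ 2 ≤ e k ∧ e k ≤ ((k + 2) * (π / L)) ^ 2) :
    (Summable fun k => boseFactor β α (e k)) ∧
      |(∑' k, boseFactor β α (e k)) - L * freeDensity β α| ≤ 2 * boseFactor β α 0 := by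
  have hh : 0 < π / L := by positivity
  have hsq : ∀ x : ℝ, α < x ^ 2 := fun x => hα.trans_le (sq_nonneg x)
  obtain ⟨hs, h1, h2⟩ := riemann_sum_bounds (f := fun p => boseFactor β α (p ^ 2))
    (fun x hx y _ hxy => boseFactor_anti hβ (hsq x) (pow_le_pow_left₀ hx hxy 2))
    (fun x => boseFactor_nonneg hβ (hsq x)) (integrableOn_boseFactor hβ hα) hh
    (g := fun k => boseFactor β α (e k))
    (fun k => ⟨boseFactor_anti hβ ((hsq _).trans_le (he k).1) (he k).2,
      boseFactor_anti hβ (hsq _) (he k).1⟩)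
  refine ⟨hs, ?_⟩
  set S := ∑' k, boseFactor β α (e k)
  set I := ∫ p in Ioi (0 : ℝ), boseFactor β α (p ^ 2) with hI
  have e1 : L * freeDensity β α = (π / L)⁻¹ * I := by
    rw [freeDensity, ← hI]
    field_simp
  rw [zero_pow two_ne_zero] at h2
  rw [mul_comm, ← le_div_iff₀ hh, div_eq_inv_mul] at h1
  have h3 : (π / L)⁻¹ * I - 2 * boseFactor β α 0 ≤ S := by
    have := mul_le_mul_of_nonneg_left h2 (inv_nonneg.2 hh.le)
    rw [inv_mul_cancel_left₀ hh.ne'] at this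
    have e2 : (π / L)⁻¹ * (I - 2 * (π / L) * boseFactor β α 0)
        = (π / L)⁻¹ * I - 2 * boseFactor β α 0 := by
      field_simp
    linarith
  have := boseFactor_nonneg hβ hα
  rw [e1, abs_le]
  exact ⟨by linarith, by linarith⟩

/-! ### The mean-field tilt -/

/-- Chebyshev's correlation inequality for `f` and an antitone function of `f`. -/
theorem tsum_correlation_le {ι : Type*} {p f : ι → ℝ} {φ : ℝ → ℝ} (hp : ∀ i, 0 ≤ p i)
    (hφ : Antitone φ) (s0 : Summable p) (s1 : Summable fun i => f i * p i)
    (s2 : Summable fun i => φ (f i) * p i) (s3 : Summable fun i => f i * (φ (f i) * p i))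
    (hZ : 0 < ∑' i, p i) :
    (∑' i, f i * (φ (f i) * p i)) * ∑' i, p i ≤ (∑' i, f i * p i) * ∑' i, φ (f i) * p i := by
  set Z := ∑' i, p i
  set M := ∑' i, f i * p i
  set a := M / Z with ha
  have hMa : M = a * Z := by rw [ha, div_mul_cancel₀ _ hZ.ne']
  -- With `a` the mean of `f`, the two differences have opposite signs; summing the product gives
  -- the inequality.
  have h0 : ∀ i, (f i - a) * (φ (f i) - φ a) * p i ≤ 0 := fun i => by
    refine mul_nonpos_of_nonpos_of_nonneg ?_ (hp i)
    rcases le_total (f i) a with h | h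
    · exact mul_nonpos_of_nonpos_of_nonneg (sub_nonpos.2 h) (sub_nonneg.2 (hφ h))
    · exact mul_nonpos_of_nonneg_of_nonpos (sub_nonneg.2 h) (sub_nonpos.2 (hφ h))
  have h1 : ∑' i, (f i - a) * (φ (f i) - φ a) * p i ≤ 0 := tsum_nonpos h0
  have e : ∀ i, (f i - a) * (φ (f i) - φ a) * p i =
      f i * (φ (f i) * p i) - a * (φ (f i) * p i) - (φ a * (f i * p i) - a * φ a * p i) :=
    fun i => by ring
  simp only [e] at h1
  rw [(s3.sub (s2.mul_left a)).tsum_sub ((s1.mul_left _).sub (s0.mul_left _)),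
    s3.tsum_sub (s2.mul_left a), (s1.mul_left _).tsum_sub (s0.mul_left _), tsum_mul_left,
    tsum_mul_left, tsum_mul_left] at h1
  change _ - (φ a * M - a * φ a * Z) ≤ 0 at h1
  have h2 := mul_le_mul_of_nonneg_right h1 hZ.le
  rw [hMa] at h2 ⊢
  nlinarith

/-- The square of a mean is at most the mean of the square. -/
theorem sq_tsum_le {ι : Type*} {w f : ι → ℝ} (hw : ∀ i, 0 ≤ w i) (s0 : Summable w)
    (s1 : Summable fun i => f i * w i) (s2 : Summable fun i => f i ^ 2 * w i)
    (hZ : 0 < ∑' i, w i) :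
    ((∑' i, f i * w i) / ∑' i, w i) ^ 2 ≤ (∑' i, f i ^ 2 * w i) / ∑' i, w i := by
  set Z := ∑' i, w i
  set M := ∑' i, f i * w i
  set a := M / Z with ha
  have hMa : M = a * Z := by rw [ha, div_mul_cancel₀ _ hZ.ne']
  have h1 : 0 ≤ ∑' i, (f i - a) ^ 2 * w i := tsum_nonneg fun i => mul_nonneg (sq_nonneg _) (hw i)
  have e : ∀ i, (f i - a) ^ 2 * w i = f i ^ 2 * w i - 2 * a * (f i * w i) + a ^ 2 * w i :=
    fun i => by ring
  simp only [e] at h1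
  rw [(s2.sub (s1.mul_left _)).tsum_add (s0.mul_left _), s2.tsum_sub (s1.mul_left _),
    tsum_mul_left, tsum_mul_left] at h1
  change 0 ≤ _ - 2 * a * M + a ^ 2 * Z at h1
  rw [le_div_iff₀ hZ]
  rw [hMa] at h1
  linarith

/-- The indicator of the modes `k ≥ 2`. -/
def upperMode (k : ℕ) : ℝ := if 2 ≤ k then 1 else 0

theorem upperMode_nonneg (k : ℕ) : 0 ≤ upperMode k := by unfold upperMode; split_ifs <;> norm_num

theorem upperMode_le_one (k : ℕ) : upperMode k ≤ 1 := by unfold upperMode; split_ifs <;> norm_num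

/-- The product weight with the mean-field tilt `exp(b Ñ - a Ñ²)`. -/
def tiltedWeight (t : ℕ → ℝ) (a b : ℝ) (n : Occ) : ℝ :=
  exp (b * count upperMode n - a * count upperMode n ^ 2) * weight t n

/-- The mean of `Ñ` in the tilted weight. -/
def tiltedMean (t : ℕ → ℝ) (a b : ℝ) : ℝ :=
  (∑' n, count upperMode n * tiltedWeight t a b n) / ∑' n, tiltedWeight t a b n

variable {t : ℕ → ℝ} {q a b : ℝ}

/-- The tilt is bounded, so tilted sums inherit summability from the product weight. -/
theorem tilt_le (ha : 0 < a) (b x : ℝ) : exp (b * x - a * x ^ 2) ≤ exp (b ^ 2 / (4 * a)) := by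
  refine exp_le_exp.2 ?_
  rw [le_div_iff₀ (by positivity)]
  nlinarith [sq_nonneg (b - 2 * a * x)]

theorem tiltedWeight_nonneg (h0 : ∀ k, 0 ≤ t k) (n : Occ) : 0 ≤ tiltedWeight t a b n :=
  mul_nonneg (exp_pos _).le (weight_nonneg h0 n)

theorem summable_mul_tiltedWeight (h0 : ∀ k, 0 ≤ t k) (hq0 : 0 ≤ q) (hq : q < 1)
    (htq : ∀ k, t k ≤ q) (ht : Summable t) (ha : 0 < a) {g : Occ → ℝ} (hg0 : ∀ n, 0 ≤ g n)
    (hg : ∀ n, g n ≤ (count (fun _ => 1) n + 1) ^ 2) :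
    Summable fun n => g n * tiltedWeight t a b n := by
  refine Summable.of_nonneg_of_le (fun n => mul_nonneg (hg0 n) (tiltedWeight_nonneg h0 n))
    (fun n => ?_) ((summable_sq_mul_weight h0 hq0 hq htq ht).mul_left (exp (b ^ 2 / (4 * a))))
  rw [tiltedWeight, mul_left_comm]
  exact mul_le_mul (tilt_le ha b _) (mul_le_mul_of_nonneg_right (hg n) (weight_nonneg h0 n))
    (mul_nonneg (hg0 n) (weight_nonneg h0 n)) (exp_pos _).le

theorem count_upperMode_nonneg (n : Occ) : 0 ≤ count upperMode n := count_nonneg upperMode_nonneg n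

theorem count_upperMode_le (n : Occ) : count upperMode n ≤ count (fun _ => 1) n :=
  count_mono upperMode_le_one n

theorem summable_tiltedWeight (h0 : ∀ k, 0 ≤ t k) (hq0 : 0 ≤ q) (hq : q < 1)
    (htq : ∀ k, t k ≤ q) (ht : Summable t) (ha : 0 < a) : Summable (tiltedWeight t a b) := by
  simpa using summable_mul_tiltedWeight (b := b) h0 hq0 hq htq ht ha (g := fun _ => 1)
    (fun _ => zero_le_one) fun n => by
      nlinarith [(count_upperMode_nonneg n).trans (count_upperMode_le n)]

theorem summable_count_mul_tiltedWeight (h0 : ∀ k, 0 ≤ t k) (hq0 : 0 ≤ q) (hq : q < 1)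
    (htq : ∀ k, t k ≤ q) (ht : Summable t) (ha : 0 < a) :
    Summable fun n => count upperMode n * tiltedWeight t a b n :=
  summable_mul_tiltedWeight h0 hq0 hq htq ht ha count_upperMode_nonneg fun n => by
    nlinarith [count_upperMode_nonneg n, count_upperMode_le n]

theorem summable_sq_mul_tiltedWeight (h0 : ∀ k, 0 ≤ t k) (hq0 : 0 ≤ q) (hq : q < 1)
    (htq : ∀ k, t k ≤ q) (ht : Summable t) (ha : 0 < a) :
    Summable fun n => count upperMode n ^ 2 * tiltedWeight t a b n :=
  summable_mul_tiltedWeight h0 hq0 hq htq ht ha (fun n => sq_nonneg _) fun n =>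
    pow_le_pow_left₀ (count_upperMode_nonneg n) (by linarith [count_upperMode_le n]) 2

theorem tsum_tiltedWeight_pos (h0 : ∀ k, 0 ≤ t k) (hq0 : 0 ≤ q) (hq : q < 1)
    (htq : ∀ k, t k ≤ q) (ht : Summable t) (ha : 0 < a) : 0 < ∑' n, tiltedWeight t a b n :=
  (summable_tiltedWeight h0 hq0 hq htq ht ha).tsum_pos (tiltedWeight_nonneg h0) 0
    (by rw [tiltedWeight, weight_zero, mul_one]; exact exp_pos _)

/-- Lowering `b` multiplies the weight by a decreasing function of `Ñ`, to which the correlation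
inequality applies. -/
theorem tiltedMean_mono (h0 : ∀ k, 0 ≤ t k) (hq0 : 0 ≤ q) (hq : q < 1)
    (htq : ∀ k, t k ≤ q) (ht : Summable t) (ha : 0 < a) {b' : ℝ} (hb : b ≤ b') :
    tiltedMean t a b ≤ tiltedMean t a b' := by
  have e : ∀ n, tiltedWeight t a b n =
      exp (-(b' - b) * count upperMode n) * tiltedWeight t a b' n := fun n => by
    rw [tiltedWeight, tiltedWeight, ← mul_assoc, ← exp_add]
    ring_nf
  rw [tiltedMean, tiltedMean, div_le_div_iff₀ (tsum_tiltedWeight_pos h0 hq0 hq htq ht ha)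
    (tsum_tiltedWeight_pos h0 hq0 hq htq ht ha)]
  have h := tsum_correlation_le (p := tiltedWeight t a b') (f := count upperMode)
    (φ := fun y => exp (-(b' - b) * y)) (tiltedWeight_nonneg h0)
    (fun x y hxy => exp_le_exp.2 (by nlinarith)) (summable_tiltedWeight h0 hq0 hq htq ht ha)
    (summable_count_mul_tiltedWeight h0 hq0 hq htq ht ha)
    (by simpa only [← e] using summable_tiltedWeight h0 hq0 hq htq ht ha)
    (by simpa only [← e] using summable_count_mul_tiltedWeight h0 hq0 hq htq ht ha)
    (tsum_tiltedWeight_pos h0 hq0 hq htq ht ha)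
  simpa only [← e] using h

/-- The tilted mean is close to the centre of the tilt if the free mean is. -/
theorem abs_tiltedMean_sub_le (h0 : ∀ k, 0 ≤ t k) (hq0 : 0 ≤ q) (hq : q < 1)
    (htq : ∀ k, t k ≤ q) (ht : Summable t) (ha : 0 < a) {R V : ℝ}
    (hR : R = ∑' k, upperMode k * occupation (t k))
    (hV : V = ∑' k, upperMode k ^ 2 * (occupation (t k) * (1 + occupation (t k)))) :
    |tiltedMean t a b - b / (2 * a)| ≤ √V + |R - b / (2 * a)| := by
  set m := b / (2 * a) with hm
  have hbm : b = 2 * a * m := by rw [hm]; field_simp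
  set U := count upperMode with hU
  obtain ⟨m1, m2⟩ := moments h0 hq0 hq htq ht upperMode_nonneg upperMode_le_one
  rw [← hR] at m1 m2
  rw [← hV] at m2
  set Z := ∑' n, weight t n with hZ
  have sp : Summable (weight t) := summable_weight h0 hq htq ht
  have hZ0 : 0 < Z := sp.tsum_pos (weight_nonneg h0) 0 (by rw [weight_zero]; exact one_pos)
  have hdom : ∀ g : Occ → ℝ, (∀ n, 0 ≤ g n) → (∀ n, g n ≤ (count (fun _ => 1) n + 1) ^ 2) →
      Summable fun n => g n * weight t n := fun g hg0 hg =>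
    Summable.of_nonneg_of_le (fun n => mul_nonneg (hg0 n) (weight_nonneg h0 n))
      (fun n => mul_le_mul_of_nonneg_right (hg n) (weight_nonneg h0 n))
      (summable_sq_mul_weight h0 hq0 hq htq ht)
  have spU : Summable fun n => U n * weight t n := hdom U count_upperMode_nonneg fun n => by
    nlinarith [count_upperMode_nonneg n, count_upperMode_le n]
  have spUU : Summable fun n => U n ^ 2 * weight t n := hdom _ (fun n => sq_nonneg _) fun n =>
    pow_le_pow_left₀ (count_upperMode_nonneg n) (by linarith [count_upperMode_le n]) 2
  have V0 : 0 ≤ V := by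
    rw [hV]
    refine tsum_nonneg fun k => mul_nonneg (sq_nonneg _) ?_
    have := occupation_nonneg (h0 k) ((htq k).trans_lt hq)
    positivity
  have ex : ∀ (w : Occ → ℝ) n, (U n - m) ^ 2 * w n =
      U n ^ 2 * w n - 2 * m * (U n * w n) + m ^ 2 * w n := fun w n => by ring
  have spX : Summable fun n => (U n - m) ^ 2 * weight t n := by
    simp only [ex]
    exact (spUU.sub (spU.mul_left _)).add (sp.mul_left _)
  have eX : ∑' n, (U n - m) ^ 2 * weight t n = (V + (R - m) ^ 2) * Z := by
    simp only [ex]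
    rw [(spUU.sub (spU.mul_left _)).tsum_add (sp.mul_left _), spUU.tsum_sub (spU.mul_left _),
      tsum_mul_left, tsum_mul_left, m1, m2]
    ring
  set w := tiltedWeight t a b with hw
  have sw : Summable w := summable_tiltedWeight h0 hq0 hq htq ht ha
  have swU : Summable fun n => U n * w n := summable_count_mul_tiltedWeight h0 hq0 hq htq ht ha
  have swUU : Summable fun n => U n ^ 2 * w n := summable_sq_mul_tiltedWeight h0 hq0 hq htq ht ha
  have hw0 : 0 < ∑' n, w n := tsum_tiltedWeight_pos h0 hq0 hq htq ht ha
  have swX : Summable fun n => (U n - m) ^ 2 * w n := by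
    simp only [ex]
    exact (swUU.sub (swU.mul_left _)).add (sw.mul_left _)
  have e1 : ∀ n, (U n - m) * w n = U n * w n - m * w n := fun n => by ring
  have swX1 : Summable fun n => (U n - m) * w n := by
    simp only [e1]
    exact swU.sub (sw.mul_left _)
  -- Completing the square: up to a constant, the tilt is a Gaussian centred at `m`.
  have ew : ∀ n, exp (-a * (U n - m) ^ 2) * weight t n = exp (-(a * m ^ 2)) * w n := fun n => by
    rw [hw, tiltedWeight, ← mul_assoc, ← exp_add, hbm, ← hU]
    ring_nf
  have eXw : ∀ n, (U n - m) ^ 2 * (exp (-(a * m ^ 2)) * w n) =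
      exp (-(a * m ^ 2)) * ((U n - m) ^ 2 * w n) := fun n => by ring
  -- The Gaussian decreases in `(U - m) ^ 2`, so the tilted mean of this square is at most its free
  -- mean `V + (R - m) ^ 2`.
  have hcor := tsum_correlation_le (p := weight t) (f := fun n => (U n - m) ^ 2)
    (φ := fun y => exp (-a * y)) (weight_nonneg h0)
    (fun x y hxy => exp_le_exp.2 (by nlinarith)) sp spX
    (by simp only [ew]; exact sw.mul_left _) (by simp only [ew, eXw]; exact swX.mul_left _) hZ0
  simp only [ew, eXw] at hcor
  rw [tsum_mul_left, tsum_mul_left, eX] at hcor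
  have hEx : 0 < exp (-(a * m ^ 2)) := exp_pos _
  have hX2 : (∑' n, (U n - m) ^ 2 * w n) / ∑' n, w n ≤ V + (R - m) ^ 2 := by
    rw [div_le_iff₀ hw0]
    refine le_of_mul_le_mul_right ?_ (mul_pos hEx hZ0)
    linarith
  have hX1 := (sq_tsum_le (fun n => tiltedWeight_nonneg h0 n) sw swX1 swX hw0).trans hX2
  have hmean : (∑' n, (U n - m) * w n) / ∑' n, w n = tiltedMean t a b - m := by
    simp only [e1]
    rw [swU.tsum_sub (sw.mul_left _), tsum_mul_left, sub_div, mul_div_cancel_right₀ _ hw0.ne']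
    rfl
  rw [hmean] at hX1
  refine abs_le_of_sq_le_sq (hX1.trans ?_) (by positivity)
  have := sq_sqrt V0
  have := sq_abs (R - m)
  nlinarith [mul_nonneg (sqrt_nonneg V) (abs_nonneg (R - m))]

/-- The mean occupation number of a mode that does not enter the tilt. -/
theorem tiltedWeight_occupation (h0 : ∀ k, 0 ≤ t k) (hq0 : 0 ≤ q) (hq : q < 1)
    (htq : ∀ k, t k ≤ q) (ht : Summable t) (ha : 0 < a) {k : ℕ} (hk : k < 2) :
    (Summable fun n : Occ => (n k : ℝ) * tiltedWeight t a b n) ∧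
    (∑' n : Occ, (n k : ℝ) * tiltedWeight t a b n) =
      occupation (t k) * ∑' n, tiltedWeight t a b n := by
  have hs : Summable fun n : Occ => (n k : ℝ) * tiltedWeight t a b n :=
    summable_mul_tiltedWeight h0 hq0 hq htq ht ha (fun n => Nat.cast_nonneg _) fun n => by
      have h1 := (hasSum_count (fun _ => 1) n).summable.le_tsum k fun j _ => by positivity
      rw [(hasSum_count (fun _ => 1) n).tsum_eq, one_mul] at h1
      nlinarith [(count_upperMode_nonneg n).trans (count_upperMode_le n)]
  refine ⟨hs, (occupation_eq_iff ((htq k).trans_lt hq)).1 ?_⟩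
  refine (tsum_shift t (fun n => exp (b * count upperMode n - a * count upperMode n ^ 2)) k).trans
    (congrArg (t k * ·) ?_)
  rw [← hs.tsum_add (summable_tiltedWeight h0 hq0 hq htq ht ha)]
  refine tsum_congr fun n => ?_
  have : upperMode k = 0 := by simp [upperMode, hk]
  simp only [count_add_single, this, add_zero, tiltedWeight]
  ring

/-! ### The Gibbs state as a tilted product weight -/

/-- The diagonal elements of the Gibbs operator. -/
def gibbsWeight (σ lam β L μ : ℝ) (n : Occ) : ℝ :=
  exp (-β * (count (level σ L) n + lam / 2 / L * count upperMode n ^ 2 -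
    μ * count (fun _ => 1) n))

theorem upperNumber_ket (n : Occ) :
    upperNumber (ket n) = ((count upperMode n : ℝ) : ℂ) • ket n := modeSum_ket upperMode n

theorem totalNumber_ket (n : Occ) :
    totalNumber (ket n) = ((count (fun _ => 1) n : ℝ) : ℂ) • ket n := modeSum_ket (fun _ => 1) n

theorem diagElem_of_ket {A : FockCore →ₗ[ℂ] FockCore} {n : Occ} {c : ℂ} (h : A (ket n) = c • ket n) :
    diagElem A n = c := by
  rw [diagElem, h]
  simp [ket]

theorem gibbsOp_ket (σ lam β L μ : ℝ) (n : Occ) :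
    gibbsOp σ lam β L μ (ket n) = ((gibbsWeight σ lam β L μ n : ℝ) : ℂ) • ket n := by
  rw [gibbsOp, opOfKet_ket, diagElem_of_ket (c := ((count (level σ L) n +
    lam / 2 / L * count upperMode n ^ 2 - μ * count (fun _ => 1) n : ℝ) : ℂ))]
  · rw [gibbsWeight]
    push_cast
    rfl
  · simp only [grandHamiltonian, hamiltonian, LinearMap.sub_apply, LinearMap.add_apply,
      LinearMap.smul_apply, LinearMap.comp_apply, upperNumber_ket, totalNumber_ket, map_smul,
      smul_smul]
    rw [modeSum_ket, ← add_smul, ← sub_smul]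
    congr 1
    simp only [count]
    push_cast
    ring

theorem gibbsState_eq (σ lam β L μ : ℝ) {X : FockCore →ₗ[ℂ] FockCore} {f : Occ → ℝ}
    (hX : ∀ n, X (ket n) = ((f n : ℝ) : ℂ) • ket n) :
    gibbsState σ lam β L μ X = (((∑' n, f n * gibbsWeight σ lam β L μ n) /
      ∑' n, gibbsWeight σ lam β L μ n : ℝ) : ℂ) := by
  have h1 : ∀ n, diagElem (gibbsOp σ lam β L μ) n = ((gibbsWeight σ lam β L μ n : ℝ) : ℂ) :=
    fun n => diagElem_of_ket (gibbsOp_ket σ lam β L μ n)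
  have h2 : ∀ n, diagElem (X ∘ₗ gibbsOp σ lam β L μ) n =
      ((f n * gibbsWeight σ lam β L μ n : ℝ) : ℂ) := fun n => by
    refine diagElem_of_ket ?_
    rw [LinearMap.comp_apply, gibbsOp_ket, map_smul, hX, smul_smul]
    push_cast
    rw [mul_comm]
  simp only [gibbsState, fockTrace, h1, h2]
  rw [← Complex.ofReal_tsum, ← Complex.ofReal_tsum, ← Complex.ofReal_div]

theorem count_single (c : ℕ → ℝ) (k m : ℕ) : count c (Finsupp.single k m) = c k * m := by
  rw [count, Finsupp.sum_single_index (by simp)]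

/-- In a state of trace class the chemical potential lies below the ground state energy. -/
theorem GibbsTraceClass.lt_level_zero {σ lam β L μ : ℝ} (hβ : 0 < β)
    (h : GibbsTraceClass σ lam β L μ) : μ < level σ L 0 := by
  have h1 : Summable (gibbsWeight σ lam β L μ) := by
    rw [GibbsTraceClass] at h
    simp only [diagElem_of_ket (gibbsOp_ket σ lam β L μ _)] at h
    exact Complex.summable_ofReal.1 h
  -- Configurations with only mode 0 occupied have no interaction energy and contribute a geometric
  -- series.
  have h2 := h1.comp_injective (Finsupp.single_injective (0 : ℕ))
  have e : (gibbsWeight σ lam β L μ ∘ Finsupp.single 0) =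
      fun m : ℕ => exp (-β * (level σ L 0 - μ)) ^ m := by
    funext m
    simp only [Function.comp_apply, gibbsWeight, count_single, ← exp_nat_mul, upperMode]
    congr 1
    norm_num
    ring
  rw [e, summable_geometric_iff_norm_lt_one, norm_of_nonneg (exp_pos _).le, exp_lt_one_iff] at h2
  nlinarith

theorem count_one_eq (n : Occ) :
    count (fun _ => 1) n = n 0 + n 1 + count upperMode n := by
  have h1 := (hasSum_count (fun _ => 1) n).sub (hasSum_count upperMode n)
  have h2 : HasSum (fun k => 1 * (n k : ℝ) - upperMode k * n k)
      (∑ k ∈ Finset.range 2, (1 * (n k : ℝ) - upperMode k * n k)) := by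
    refine hasSum_sum_of_ne_finset_zero fun k hk => ?_
    have : 2 ≤ k := not_lt.1 fun h => hk (Finset.mem_range.2 h)
    simp [upperMode, this]
  have h3 := h1.unique h2
  simp only [Finset.sum_range_succ, Finset.sum_range_zero, upperMode] at h3
  norm_num at h3
  linarith

/-- The mode weights: at chemical potential `μ` for the two lowest modes and `α` for the others. -/
def modeWeight (σ β L μ α : ℝ) (k : ℕ) : ℝ :=
  exp (-β * (level σ L k - if k < 2 then μ else α))

/-- The parameter `α` is free: the difference `μ - α` for the upper modes goes into the linear part
of the tilt. It is later chosen so that the Gaussian is centred near the free mean. -/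
theorem gibbsWeight_eq_tiltedWeight (σ lam β L μ α : ℝ) :
    gibbsWeight σ lam β L μ =
      tiltedWeight (modeWeight σ β L μ α) (β * lam / (2 * L)) (β * (μ - α)) := by
  funext n
  let x : ℕ → ℝ := fun k => β * (level σ L k - if k < 2 then μ else α)
  have e1 : weight (modeWeight σ β L μ α) n = exp (-count x n) := by
    rw [exp_neg_count]
    congr 1
    funext k
    rw [modeWeight, neg_mul]
  have e2 : count x n = β * count (level σ L) n - β * μ * count (fun _ => 1) n +
      β * (μ - α) * count upperMode n := by
    simp only [count, Finsupp.sum, Finset.mul_sum, ← Finset.sum_sub_distrib,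
      ← Finset.sum_add_distrib, x, upperMode]
    refine Finset.sum_congr rfl fun k _ => ?_
    rcases lt_or_ge k 2 with hk | hk
    · rw [if_pos hk, if_neg (not_le.2 hk)]
      ring
    · rw [if_neg (not_lt.2 hk), if_pos hk]
      ring
  rw [tiltedWeight, e1, e2, ← exp_add, gibbsWeight]
  congr 1
  field_simp
  ring

/-- The finite-volume error of the density of the upper modes. -/
def densityError (β α L : ℝ) : ℝ :=
  √((1 + boseFactor β α 0) * (L * freeDensity β α + 2 * boseFactor β α 0)) + 2 * boseFactor β α 0

/-- The occupation of the lowest modes and the total particle number in a large box. -/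
theorem gibbsState_bounds {σ lam β L μ α : ℝ} (hσ : σ < 0) (hlam : 0 < lam) (hβ : 0 < β)
    (hL : 4 / -σ < L) (hα : α < 0) (hαs : α + lam * freeDensity β α = -σ ^ 2)
    (hμ : μ < level σ L 0) :
    gibbsState σ lam β L μ (number 0) = ((boseFactor β μ (level σ L 0) : ℝ) : ℂ) ∧
    gibbsState σ lam β L μ (number 1) = ((boseFactor β μ (level σ L 1) : ℝ) : ℂ) ∧
    gibbsState σ lam β L μ (number 0 + number 1) =
      ((boseFactor β μ (level σ L 0) + boseFactor β μ (level σ L 1) : ℝ) : ℂ) ∧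
    ∃ D : ℝ, gibbsState σ lam β L μ totalNumber =
        ((boseFactor β μ (level σ L 0) + boseFactor β μ (level σ L 1) + D : ℝ) : ℂ) ∧
      D ≤ L * freeDensity β α + densityError β α L ∧
      |D - L * freeDensity β α| ≤ densityError β α L + 2 / lam * L * |μ + σ ^ 2| := by
  have hs : 0 < -σ := by linarith
  have hL0 : 0 < L := lt_trans (by positivity) hL
  obtain ⟨⟨-, hε0⟩, ⟨hε1, -⟩, hε⟩ := level_bounds hσ hL
  set t := modeWeight σ β L μ α with ht
  set a := β * lam / (2 * L) with ha
  have ha0 : 0 < a := by positivity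
  have t0 : t 0 = exp (-β * (level σ L 0 - μ)) := rfl
  have t1 : t 1 = exp (-β * (level σ L 1 - μ)) := rfl
  have t2 : ∀ k, t (k + 2) = exp (-β * (level σ L (k + 2) - α)) := fun k => by
    rw [ht, modeWeight, if_neg (by omega)]
  have hpos : ∀ k, 0 ≤ level σ L (k + 2) := fun k => (sq_nonneg _).trans (hε k).1
  have h0 : ∀ k, 0 ≤ t k := fun k => (exp_pos _).le
  obtain ⟨q, hq0, hq, htq⟩ : ∃ q, 0 ≤ q ∧ q < 1 ∧ ∀ k, t k ≤ q := by
    refine ⟨max (t 0) (exp (-β * (0 - α))), le_max_of_le_left (h0 0),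
      max_lt (boseWeight_lt_one hβ hμ) (boseWeight_lt_one hβ hα), fun k => ?_⟩
    match k with
    | 0 => exact le_max_left _ _
    | 1 =>
      refine le_max_of_le_left ?_
      rw [t0, t1]
      exact exp_le_exp.2 (by nlinarith)
    | k + 2 =>
      refine le_max_of_le_right ?_
      rw [t2]
      exact exp_le_exp.2 (by nlinarith [hpos k])
  obtain ⟨sR, hR⟩ := boseFactor_sum_bounds hβ hα hL0 hε
  have ho : ∀ k, occupation (t (k + 2)) = boseFactor β α (level σ L (k + 2)) := fun k => by
    rw [t2, boseFactor]
  have st : Summable t := by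
    refine (summable_nat_add_iff 2).1 (Summable.of_nonneg_of_le (fun k => h0 _) (fun k => ?_) sR)
    rw [← ho, occupation, le_div_iff₀ (by linarith [htq (k + 2)])]
    nlinarith [h0 (k + 2)]
  set R := ∑' k, boseFactor β α (level σ L (k + 2)) with hRdef
  have hsplit : ∀ g : ℕ → ℝ, Summable (fun k => g (k + 2)) → g 0 = 0 → g 1 = 0 →
      ∑' k, g k = ∑' k, g (k + 2) := fun g hg g0 g1 => by
    rw [← ((summable_nat_add_iff 2).1 hg).sum_add_tsum_nat_add 2]
    simp [Finset.sum_range_succ, g0, g1]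
  have u2 : ∀ k, upperMode (k + 2) = 1 := fun k => by simp [upperMode]
  have u0 : upperMode 0 = 0 := by simp [upperMode]
  have u1 : upperMode 1 = 0 := by simp [upperMode]
  have hR1 : R = ∑' k, upperMode k * occupation (t k) := by
    rw [hsplit _ (by simpa only [u2, ho, one_mul] using sR) (by simp [u0]) (by simp [u1])]
    simp only [u2, ho, one_mul, hRdef]
  set B := boseFactor β α 0 with hB
  have hB0 : 0 ≤ B := boseFactor_nonneg hβ hα
  have hr0 : ∀ k, 0 ≤ boseFactor β α (level σ L (k + 2)) := fun k =>
    boseFactor_nonneg hβ (hα.trans_le (hpos k))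
  have hrB : ∀ k, boseFactor β α (level σ L (k + 2)) *
      (1 + boseFactor β α (level σ L (k + 2))) ≤
      (1 + B) * boseFactor β α (level σ L (k + 2)) := fun k => by
    have := boseFactor_anti hβ hα (hpos k)
    rw [mul_comm]
    exact mul_le_mul_of_nonneg_right (by linarith) (hr0 k)
  have sV : Summable fun k => boseFactor β α (level σ L (k + 2)) *
      (1 + boseFactor β α (level σ L (k + 2))) :=
    Summable.of_nonneg_of_le (fun k => mul_nonneg (hr0 k) (by linarith [hr0 k])) hrB
      (sR.mul_left _)
  -- The free variance is `O(L)` because each occupation is at most `B`, a bound independent of `L`.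
  have hV1 : ∑' k, upperMode k ^ 2 * (occupation (t k) * (1 + occupation (t k))) ≤ (1 + B) * R := by
    rw [hsplit _ (by simpa only [u2, ho, one_pow, one_mul] using sV) (by simp [u0]) (by simp [u1])]
    simp only [u2, ho, one_pow, one_mul]
    rw [hRdef, ← tsum_mul_left]
    exact sV.tsum_le_tsum hrB (sR.mul_left _)
  have hRle := (abs_le.1 hR).2
  have hVle : √(∑' k, upperMode k ^ 2 * (occupation (t k) * (1 + occupation (t k)))) ≤
      √((1 + B) * (L * freeDensity β α + 2 * B)) :=
    sqrt_le_sqrt (hV1.trans (mul_le_mul_of_nonneg_left (by linarith) (by linarith)))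
  -- Here `ν` varies only in the tilt, while `t` keeps `μ`. The factor 2 counts the offset of the
  -- centre once from the tilted mean and once from the free mean.
  have hmean : ∀ ν : ℝ, |tiltedMean t a (β * (ν - α)) - L * freeDensity β α| ≤
      densityError β α L + 2 / lam * L * |ν + σ ^ 2| := fun ν => by
    have h1 := abs_tiltedMean_sub_le (b := β * (ν - α)) h0 hq0 hq htq st ha0 hR1 rfl
    -- Self-consistency of `α` places the centre at `L * freeDensity β α` when `ν = -σ ^ 2`.
    have h2 : β * (ν - α) / (2 * a) = L * freeDensity β α + L * (ν + σ ^ 2) / lam := by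
      have : ν - α = lam * freeDensity β α + (ν + σ ^ 2) := by linarith
      rw [ha, this]
      field_simp
    have h3 : |L * (ν + σ ^ 2) / lam| = L / lam * |ν + σ ^ 2| := by
      rw [abs_div, abs_mul, abs_of_pos hL0, abs_of_pos hlam]
      ring
    rw [h2] at h1
    have h4 := abs_add_le (tiltedMean t a (β * (ν - α)) -
      (L * freeDensity β α + L * (ν + σ ^ 2) / lam)) (L * (ν + σ ^ 2) / lam)
    have h5 := abs_sub (R - L * freeDensity β α) (L * (ν + σ ^ 2) / lam)
    rw [h3] at h4 h5
    rw [sub_sub] at h5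
    rw [show tiltedMean t a (β * (ν - α)) - (L * freeDensity β α + L * (ν + σ ^ 2) / lam) +
      L * (ν + σ ^ 2) / lam = tiltedMean t a (β * (ν - α)) - L * freeDensity β α by ring] at h4
    have h6 : 2 / lam * L * |ν + σ ^ 2| = 2 * (L / lam * |ν + σ ^ 2|) := by ring
    rw [densityError, ← hB, h6]
    linarith
  have hw : gibbsWeight σ lam β L μ = tiltedWeight t a (β * (μ - α)) :=
    gibbsWeight_eq_tiltedWeight σ lam β L μ α
  set w := tiltedWeight t a (β * (μ - α)) with hwdef
  have hZ : 0 < ∑' n, w n := tsum_tiltedWeight_pos h0 hq0 hq htq st ha0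
  have hn : ∀ k (n : Occ), number k (ket n) = (((n k : ℝ) : ℝ) : ℂ) • ket n := fun k n => by
    rw [number_ket]
    norm_cast
  obtain ⟨s0, e0⟩ := tiltedWeight_occupation (b := β * (μ - α)) h0 hq0 hq htq st ha0 (k := 0)
    (by norm_num)
  obtain ⟨s1, e1⟩ := tiltedWeight_occupation (b := β * (μ - α)) h0 hq0 hq htq st ha0 (k := 1)
    (by norm_num)
  have sU := summable_count_mul_tiltedWeight (b := β * (μ - α)) h0 hq0 hq htq st ha0
  rw [← hwdef] at s0 e0 s1 e1 sU
  have o0 : occupation (t 0) = boseFactor β μ (level σ L 0) := by rw [t0, boseFactor]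
  have o1 : occupation (t 1) = boseFactor β μ (level σ L 1) := by rw [t1, boseFactor]
  rw [o0] at e0
  rw [o1] at e1
  refine ⟨?_, ?_, ?_, tiltedMean t a (β * (μ - α)), ?_, ?_, hmean μ⟩
  · rw [gibbsState_eq σ lam β L μ (hn 0), hw, e0, mul_div_cancel_right₀ _ hZ.ne']
  · rw [gibbsState_eq σ lam β L μ (hn 1), hw, e1, mul_div_cancel_right₀ _ hZ.ne']
  · rw [gibbsState_eq σ lam β L μ (f := fun n => (n 0 : ℝ) + n 1) fun n => by
      rw [LinearMap.add_apply, hn, hn, ← add_smul]; push_cast; rfl, hw]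
    simp only [add_mul]
    rw [s0.tsum_add s1, e0, e1, ← add_mul, mul_div_cancel_right₀ _ hZ.ne']
  · rw [gibbsState_eq σ lam β L μ totalNumber_ket, hw]
    simp only [count_one_eq, add_mul]
    rw [(s0.add s1).tsum_add sU, s0.tsum_add s1, e0, e1, ← add_mul, add_div,
      mul_div_cancel_right₀ _ hZ.ne']
    rfl
  -- Since `μ < -σ ^ 2`, the mean is at most its value at `ν = -σ ^ 2`, where the offset term
  -- vanishes.
  · have h1 := tiltedMean_mono h0 hq0 hq htq st ha0
      (show β * (μ - α) ≤ β * (-σ ^ 2 - α) from mul_le_mul_of_nonneg_left (by linarith) hβ.le)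
    have h2 := (abs_le.1 (hmean (-σ ^ 2))).2
    rw [neg_add_cancel, abs_zero, mul_zero, add_zero] at h2
    linarith

/-- The error is of order `√L`, the fluctuation scale of the free gas at `α < 0`; in the variable `1
/ L` the limit is continuity at 0. -/
theorem tendsto_densityError_div {β α : ℝ} :
    Tendsto (fun L => densityError β α L / L) atTop (𝓝 0) := by
  set B := boseFactor β α 0 with hB
  set d := freeDensity β α
  have hinv := tendsto_inv_atTop_zero (𝕜 := ℝ)
  have h1 : Tendsto (fun L : ℝ => √((1 + B) * (d * L⁻¹ + 2 * B * L⁻¹ ^ 2)) + 2 * B * L⁻¹) atTop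
      (𝓝 0) := by
    have hc : Continuous fun z : ℝ => √((1 + B) * (d * z + 2 * B * z ^ 2)) + 2 * B * z := by
      fun_prop
    have := (hc.tendsto 0).comp hinv
    simpa [Function.comp_def] using this
  refine h1.congr' ?_
  filter_upwards [eventually_gt_atTop 0] with L hL
  rw [densityError, add_div, ← hB]
  congr 1
  have e : (1 + B) * (d * L⁻¹ + 2 * B * L⁻¹ ^ 2) = (1 + B) * (L * d + 2 * B) / L ^ 2 := by
    field_simp
  rw [e, sqrt_div' _ (sq_nonneg L), sqrt_sq hL.le]

/-! ### The thermodynamic limit -/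

theorem exp_mul_boseFactor {β μ e : ℝ} (hβ : 0 < β) (h : μ < e) :
    exp (β * (e - μ)) * boseFactor β μ e = boseFactor β μ e + 1 := by
  have h1 := boseWeight_lt_one hβ h
  have h2 : exp (β * (e - μ)) * exp (-β * (e - μ)) = 1 := by
    rw [← exp_add]
    simp
  have h3 : 1 - exp (-β * (e - μ)) ≠ 0 := by linarith
  rw [boseFactor, occupation, mul_div_assoc', h2]
  generalize exp (-β * (e - μ)) = w at h3
  field_simp
  ring

theorem boseFactor_pos {β μ e : ℝ} (hβ : 0 < β) (h : μ < e) : 0 < boseFactor β μ e :=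
  div_pos (exp_pos _) (sub_pos.2 (boseWeight_lt_one hβ h))

/-- Condensation on two asymptotically degenerate levels `e₀ ≤ e₁` near `ν`, when the density of
all other particles is asymptotically at most `d`, and equal to `d` if `μ` approaches `ν`. -/
theorem condensate_limits {β K ρ d ν : ℝ} (hβ : 0 < β) (hK : 0 ≤ K)
    {e₀ e₁ μ η : ℝ → ℝ} (hη : Tendsto η atTop (𝓝 0))
    (he₀ : Tendsto (fun L => L * (e₀ L - ν)) atTop (𝓝 0))
    (he₁ : Tendsto (fun L => L * (e₁ L - ν)) atTop (𝓝 0))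
    (he : ∀ᶠ L in atTop, μ L < e₀ L ∧ e₀ L ≤ ν ∧ ν ≤ e₁ L)
    (hd : ∀ᶠ L in atTop,
      ρ - (boseFactor β (μ L) (e₀ L) + boseFactor β (μ L) (e₁ L)) / L ≤ d + η L)
    (hd' : ∀ᶠ L in atTop,
      |ρ - (boseFactor β (μ L) (e₀ L) + boseFactor β (μ L) (e₁ L)) / L - d| ≤
        η L + K * |μ L - ν|) :
    Tendsto (fun L => boseFactor β (μ L) (e₀ L) / L) atTop (𝓝 (max 0 (ρ - d) / 2)) ∧
    Tendsto (fun L => boseFactor β (μ L) (e₁ L) / L) atTop (𝓝 (max 0 (ρ - d) / 2)) ∧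
    (0 < max 0 (ρ - d) →
      Tendsto (fun L => L * (μ L - (ν - 2 / (β * max 0 (ρ - d) * L)))) atTop (𝓝 0)) := by
  set c := max 0 (ρ - d) with hc
  set x : ℝ → ℝ := fun L => boseFactor β (μ L) (e₀ L) / L with hx
  set y : ℝ → ℝ := fun L => boseFactor β (μ L) (e₁ L) / L with hy
  have hinv := tendsto_inv_atTop_zero (𝕜 := ℝ)
  have he₀' : Tendsto (fun L => e₀ L - ν) atTop (𝓝 0) := by
    have := he₀.mul hinv
    rw [zero_mul] at this
    refine this.congr' ?_
    filter_upwards [eventually_gt_atTop 0] with L hL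
    field_simp
  have hS : Tendsto (fun L => x L + y L) atTop (𝓝 c) := by
    rw [Metric.tendsto_atTop']
    intro δ hδ
    suffices ∀ᶠ L in atTop, dist (x L + y L) c < δ by
      obtain ⟨N, hN⟩ := eventually_atTop.1 this
      exact ⟨N, fun n hn => hN n hn.le⟩
    have hsmall : Tendsto (fun L => η L + K * (|e₀ L - ν| + 2 / (β * δ) * L⁻¹)) atTop (𝓝 0) := by
      have := hη.add ((he₀'.abs.add (hinv.const_mul (2 / (β * δ)))).const_mul K)
      simpa using this
    filter_upwards [he, hd, hd', eventually_gt_atTop 0,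
      hη.eventually (gt_mem_nhds hδ), hsmall.eventually (gt_mem_nhds hδ)]
      with L ⟨h1, h2, h3⟩ h4 h5 hL h6 h7
    rw [add_div] at h4 h5
    change ρ - (x L + y L) ≤ d + η L at h4
    change |ρ - (x L + y L) - d| ≤ _ at h5
    have hx0 : 0 < x L := div_pos (boseFactor_pos hβ h1) hL
    have hy0 : 0 < y L := div_pos (boseFactor_pos hβ (h1.trans_le (h2.trans h3))) hL
    have hyx : y L ≤ x L := div_le_div_of_nonneg_right (boseFactor_anti hβ h1 (h2.trans h3)) hL.le
    have hlow : c < x L + y L + δ := max_lt (by linarith) (by linarith)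
    rw [dist_eq_norm, norm_eq_abs, abs_lt]
    refine ⟨by linarith, ?_⟩
    have c0 : 0 ≤ c := le_max_left _ _
    -- Below `δ` the upper bound is immediate from `c ≥ 0`. Otherwise `x L ≥ δ / 2`, and the Bose
    -- law forces `e₀ L - μ L = O(1 / L)`, so `hd'` becomes effective.
    rcases lt_or_ge (x L + y L) δ with hlt | hge
    · linarith
    · have hxδ : δ / 2 ≤ x L := by linarith
      have hu : β * (e₀ L - μ L) * boseFactor β (μ L) (e₀ L) ≤ 1 := by
        have e := exp_mul_boseFactor hβ h1
        have := mul_le_mul_of_nonneg_right (add_one_le_exp (β * (e₀ L - μ L)))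
          (boseFactor_pos hβ h1).le
        linarith
      have hbf : boseFactor β (μ L) (e₀ L) = L * x L := by
        rw [hx]
        field_simp
      rw [hbf] at hu
      have hgap : e₀ L - μ L ≤ 2 / (β * δ) * L⁻¹ := by
        rw [← div_eq_mul_inv, div_div, le_div_iff₀ (by positivity)]
        have h8 : 0 ≤ β * (e₀ L - μ L) * L :=
          mul_nonneg (mul_nonneg hβ.le (sub_nonneg.2 h1.le)) hL.le
        nlinarith
      have habs : |μ L - ν| ≤ |e₀ L - ν| + 2 / (β * δ) * L⁻¹ := by
        rw [abs_of_nonpos (by linarith), abs_of_nonpos (by linarith)]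
        linarith
      have h8 := mul_le_mul_of_nonneg_left habs hK
      have h9 := (abs_le.1 h5).1
      have : ρ - d ≤ c := le_max_right _ _
      linarith
  have hxy : Tendsto (fun L => x L - y L) atTop (𝓝 0) := by
    have hz : Tendsto (fun L => L * (e₁ L - e₀ L)) atTop (𝓝 0) := by
      have := he₁.sub he₀
      rw [sub_zero] at this
      exact this.congr fun L => by ring
    -- The factors bound `y ≤ c + 1`, `L * x + 1 ≤ (c + 2) * L` and `exp z - 1 ≤ 2 * z` in the
    -- identity `key2` below.
    have hbound : Tendsto (fun L => (c + 1) * ((c + 2) * (2 * (β * (L * (e₁ L - e₀ L))))))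
        atTop (𝓝 0) := by
      have := (((hz.const_mul β).const_mul 2).const_mul (c + 2)).const_mul (c + 1)
      simpa using this
    refine squeeze_zero' ?_ ?_ hbound
    · filter_upwards [he, eventually_gt_atTop 0] with L ⟨h1, h2, h3⟩ hL
      exact sub_nonneg.2
        (div_le_div_of_nonneg_right (boseFactor_anti hβ h1 (h2.trans h3)) hL.le)
    · filter_upwards [he, eventually_ge_atTop 1, hS.eventually (gt_mem_nhds (lt_add_one c)),
        (hz.const_mul β).eventually (gt_mem_nhds (show β * 0 < 1 by simp))]
        with L ⟨h1, h2, h3⟩ hL1 h4 h5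
      have hL : 0 < L := by linarith
      have hμ1 := h1.trans_le (h2.trans h3)
      have hx0 : 0 < x L := div_pos (boseFactor_pos hβ h1) hL
      have hy0 : 0 < y L := div_pos (boseFactor_pos hβ hμ1) hL
      have hbx : boseFactor β (μ L) (e₀ L) = L * x L := by
        rw [hx]
        field_simp
      have hby : boseFactor β (μ L) (e₁ L) = L * y L := by
        rw [hy]
        field_simp
      clear_value x y
      have E0 := exp_mul_boseFactor hβ h1
      have E1 := exp_mul_boseFactor hβ hμ1
      set z := β * (e₁ L - e₀ L) with hzdef
      have hz0 : 0 ≤ z := mul_nonneg hβ.le (by linarith)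
      have hz1 : z ≤ 1 := by
        have : z * 1 ≤ z * L := mul_le_mul_of_nonneg_left hL1 hz0
        have e : β * (L * (e₁ L - e₀ L)) = z * L := by rw [hzdef]; ring
        linarith
      have hexp : exp (β * (e₁ L - μ L)) = exp z * exp (β * (e₀ L - μ L)) := by
        rw [← exp_add, hzdef]
        ring_nf
      rw [hexp] at E1
      rw [hbx] at E0
      rw [hby] at E1
      -- Eliminating `exp (β * (e₀ L - μ L))` between the Bose laws of the two levels.
      have key : L * (x L - y L) = L * (y L * ((L * x L + 1) * (exp z - 1))) := by
        linear_combination exp z * (L * y L) * E0 - (L * x L) * E1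
      have key2 := mul_left_cancel₀ hL.ne' key
      have hez : exp z - 1 ≤ 2 * z := by
        have := abs_exp_sub_one_le (x := z) (by rwa [abs_of_nonneg hz0])
        rw [abs_of_nonneg hz0] at this
        exact (le_abs_self _).trans this
      have c0 : 0 ≤ c := le_max_left _ _
      rw [key2]
      refine mul_le_mul (by linarith) ?_ ?_ (by linarith)
      · have e : (c + 2) * (2 * (β * (L * (e₁ L - e₀ L)))) = ((c + 2) * L) * (2 * z) := by
          rw [hzdef]
          ring
        rw [e]
        refine mul_le_mul ?_ hez (sub_nonneg.2 (one_le_exp hz0)) (by positivity)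
        nlinarith
      · exact mul_nonneg (by positivity) (sub_nonneg.2 (one_le_exp hz0))
  have hxl : Tendsto x atTop (𝓝 (c / 2)) := by
    have := (hS.add hxy).div_const 2
    rw [add_zero] at this
    exact this.congr fun L => by ring
  have hyl : Tendsto y atTop (𝓝 (c / 2)) := by
    have := (hS.sub hxy).div_const 2
    rw [sub_zero] at this
    exact this.congr fun L => by ring
  refine ⟨hxl, hyl, fun hc0 => ?_⟩
  have hc2 : c / 2 ≠ 0 := (half_pos hc0).ne'
  have hup : Tendsto (fun L => (x L)⁻¹) atTop (𝓝 (c / 2)⁻¹) := hxl.inv₀ hc2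
  have hlo : Tendsto (fun L => (x L + L⁻¹)⁻¹) atTop (𝓝 (c / 2)⁻¹) := by
    have := hxl.add hinv
    rw [add_zero] at this
    exact this.inv₀ hc2
  -- With `u = β * (e₀ L - μ L)`, the bounds `1 - u ≤ exp (-u)` and `1 + u ≤ exp u` give `1 / (L * x
  -- + 1) ≤ u ≤ 1 / (L * x)`.
  have hu : Tendsto (fun L => L * (β * (e₀ L - μ L))) atTop (𝓝 (c / 2)⁻¹) := by
    refine tendsto_of_tendsto_of_tendsto_of_le_of_le' hlo hup ?_ ?_
    · filter_upwards [he, eventually_gt_atTop 0] with L ⟨h1, _, _⟩ hL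
      have hx0 : 0 < x L := div_pos (boseFactor_pos hβ h1) hL
      have E0 := exp_mul_boseFactor hβ h1
      have hbx : boseFactor β (μ L) (e₀ L) = L * x L := by
        rw [hx]
        field_simp
      rw [hbx] at E0
      set u := β * (e₀ L - μ L)
      have h2 := add_one_le_exp (-u)
      have h3 : exp (-u) * exp u = 1 := by rw [← exp_add]; simp
      have h4 : exp (-u) * (L * x L + 1) = L * x L := by rw [← E0, ← mul_assoc, h3, one_mul]
      have h5 := mul_le_mul_of_nonneg_right h2 (show 0 ≤ L * x L + 1 by positivity)
      rw [inv_le_iff_one_le_mul₀ (by positivity)]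
      have h6 : L * u * (x L + L⁻¹) = u * (L * x L + 1) := by field_simp
      rw [h6]
      linarith
    · filter_upwards [he, eventually_gt_atTop 0] with L ⟨h1, _, _⟩ hL
      have hx0 : 0 < x L := div_pos (boseFactor_pos hβ h1) hL
      have E0 := exp_mul_boseFactor hβ h1
      have hbx : boseFactor β (μ L) (e₀ L) = L * x L := by
        rw [hx]
        field_simp
      rw [hbx] at E0
      set u := β * (e₀ L - μ L)
      have h2 := mul_le_mul_of_nonneg_right (add_one_le_exp u) (mul_pos hL hx0).le
      rw [← one_div, le_div_iff₀ hx0]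
      linarith
  have := (he₀.sub (hu.div_const β)).add_const (2 / (β * c))
  have e : (0 : ℝ) - (c / 2)⁻¹ / β + 2 / (β * c) = 0 := by
    field_simp
    ring
  rw [e] at this
  refine this.congr' ?_
  filter_upwards [eventually_gt_atTop 0] with L hL
  field_simp
  ring

end AttractiveBose

end

/-! ### Assembly of the thermodynamic limit. -/

theorem mainTheorem2 (σ lam β ρ : ℝ) (hσ : σ < 0) (hlam : 0 < lam) (hβ : 0 < β) (hρ : 0 < ρ)
    (μ : ℝ → ℝ)
    (hμ : ∀ᶠ L : ℝ in Filter.atTop,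
      AttractiveBose.GibbsTraceClass σ lam β L (μ L) ∧
      AttractiveBose.gibbsState σ lam β L (μ L) AttractiveBose.totalNumber / (L : ℂ) = (ρ : ℂ)) :
    ∃ ρcond : ℝ, 0 ≤ ρcond ∧
      Filter.Tendsto
        (fun L : ℝ => AttractiveBose.gibbsState σ lam β L (μ L)
          (AttractiveBose.number 0 + AttractiveBose.number 1) / (L : ℂ))
        Filter.atTop (nhds (ρcond : ℂ)) ∧
      Filter.Tendsto
        (fun L : ℝ => AttractiveBose.gibbsState σ lam β L (μ L)
          (AttractiveBose.number 0) / (L : ℂ))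
        Filter.atTop (nhds ((ρcond / 2 : ℝ) : ℂ)) ∧
      Filter.Tendsto
        (fun L : ℝ => AttractiveBose.gibbsState σ lam β L (μ L)
          (AttractiveBose.number 1) / (L : ℂ))
        Filter.atTop (nhds ((ρcond / 2 : ℝ) : ℂ)) ∧
      (0 < ρcond →
        Asymptotics.IsLittleO Filter.atTop
          (fun L : ℝ => μ L - (-σ ^ 2 - 2 / (β * ρcond * L))) (fun L : ℝ => 1 / L)) := by
  open AttractiveBose Filter Topology Real in
  have hs : 0 < -σ := by linarith
  -- The value `-σ ^ 2` is the common limit of the two lowest levels, hence the chemical potential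
  -- at which condensation sets in.
  obtain ⟨α, hα, hαs⟩ := exists_selfConsistent (m := -σ ^ 2) hβ hlam (by nlinarith)
  set d := freeDensity β α with hd
  have hall : ∀ᶠ L : ℝ in atTop, 0 < L ∧ 4 / -σ < L ∧ μ L < level σ L 0 ∧
      gibbsState σ lam β L (μ L) totalNumber / (L : ℂ) = (ρ : ℂ) := by
    filter_upwards [hμ, eventually_gt_atTop 0, eventually_gt_atTop (4 / -σ)] with L h1 h2 h3
    exact ⟨h2, h3, h1.1.lt_level_zero hβ, h1.2⟩
  have hdens : ∀ᶠ L : ℝ in atTop, ∃ D : ℝ,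
      ρ - (boseFactor β (μ L) (level σ L 0) + boseFactor β (μ L) (level σ L 1)) / L = D / L ∧
      D ≤ L * d + densityError β α L ∧
      |D - L * d| ≤ densityError β α L + 2 / lam * L * |μ L + σ ^ 2| := by
    filter_upwards [hall] with L ⟨hL, h1, h2, h3⟩
    obtain ⟨-, -, -, D, h4, h5, h6⟩ := gibbsState_bounds hσ hlam hβ h1 hα hαs h2
    refine ⟨D, ?_, h5, h6⟩
    rw [h4, ← Complex.ofReal_div, Complex.ofReal_inj] at h3
    rw [← h3]
    ring
  have hexp : Tendsto (fun L : ℝ => L * (9 * σ ^ 2 * exp (σ * L / 2))) atTop (𝓝 0) := by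
    have h1 := (tendsto_pow_mul_exp_neg_atTop_nhds_zero 1).comp
      (tendsto_id.const_mul_atTop (half_pos hs))
    have h2 := h1.const_mul (9 * σ ^ 2 * (-σ / 2)⁻¹)
    rw [mul_zero] at h2
    refine h2.congr fun L => ?_
    have e : -(-σ / 2 * L) = σ * L / 2 := by ring
    simp only [Function.comp_apply, id, pow_one, e]
    have := hσ.ne
    field_simp
  obtain ⟨l0, l1, l2⟩ := condensate_limits (K := 2 / lam) (ρ := ρ) (d := d) (ν := -σ ^ 2) hβ
    (by positivity) (e₀ := fun L => level σ L 0) (e₁ := fun L => level σ L 1) (μ := μ)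
    (tendsto_densityError_div (β := β) (α := α))
    (by
      refine squeeze_zero_norm' ?_ hexp
      filter_upwards [hall] with L ⟨hL, h1, _, _⟩
      obtain ⟨⟨h2, h3⟩, -, -⟩ := level_bounds hσ h1
      rw [norm_mul, norm_eq_abs, norm_eq_abs, abs_of_pos hL, abs_of_nonpos (by linarith)]
      exact mul_le_mul_of_nonneg_left (by linarith) hL.le)
    (by
      refine squeeze_zero_norm' ?_ hexp
      filter_upwards [hall] with L ⟨hL, h1, _, _⟩
      obtain ⟨-, ⟨h2, h3⟩, -⟩ := level_bounds hσ h1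
      rw [norm_mul, norm_eq_abs, norm_eq_abs, abs_of_pos hL, abs_of_nonneg (by linarith)]
      exact mul_le_mul_of_nonneg_left (by linarith) hL.le)
    (by
      filter_upwards [hall] with L ⟨hL, h1, h2, _⟩
      obtain ⟨⟨-, h3⟩, ⟨h4, -⟩, -⟩ := level_bounds hσ h1
      exact ⟨h2, h3, h4⟩)
    (by
      filter_upwards [hall, hdens] with L ⟨hL, _⟩ ⟨D, h1, h2, _⟩
      rw [h1, div_le_iff₀ hL]
      have e : (d + densityError β α L / L) * L = L * d + densityError β α L := by field_simp
      rwa [e])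
    (by
      filter_upwards [hall, hdens] with L ⟨hL, _⟩ ⟨D, h1, _, h2⟩
      have e1 : D / L - d = (D - L * d) / L := by field_simp
      have e2 : densityError β α L / L + 2 / lam * |μ L - -σ ^ 2| =
          (densityError β α L + 2 / lam * L * |μ L + σ ^ 2|) / L := by
        rw [sub_neg_eq_add]
        field_simp
      rw [h1, e1, e2, abs_div, abs_of_pos hL]
      exact div_le_div_of_nonneg_right h2 hL.le)
  refine ⟨max 0 (ρ - d), le_max_left _ _, ?_, ?_, ?_, fun hc => ?_⟩
  · have h := (Complex.continuous_ofReal.tendsto _).comp (l0.add l1)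
    rw [add_halves] at h
    refine h.congr' ?_
    filter_upwards [hall] with L ⟨hL, h1, h2, _⟩
    rw [(gibbsState_bounds hσ hlam hβ h1 hα hαs h2).2.2.1]
    simp only [Function.comp_apply]
    push_cast
    ring
  · refine ((Complex.continuous_ofReal.tendsto _).comp l0).congr' ?_
    filter_upwards [hall] with L ⟨hL, h1, h2, _⟩
    rw [(gibbsState_bounds hσ hlam hβ h1 hα hαs h2).1]
    simp only [Function.comp_apply]
    push_cast
    ring
  · refine ((Complex.continuous_ofReal.tendsto _).comp l1).congr' ?_
    filter_upwards [hall] with L ⟨hL, h1, h2, _⟩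
    rw [(gibbsState_bounds hσ hlam hβ h1 hα hαs h2).2.1]
    simp only [Function.comp_apply]
    push_cast
    ring
  · rw [Asymptotics.isLittleO_iff_tendsto']
    · refine (l2 hc).congr fun L => ?_
      rw [div_div_eq_mul_div, div_one, mul_comm]
    · filter_upwards [eventually_gt_atTop 0] with L hL h
      exact absurd h (one_div_pos.2 hL).ne'
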